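/- All manifolds are smooth, Hausdorff and second countable. A smooth Lorentzian manifold $(M,g)$ is a manifold $M$ of dimension $d+1$ with $d\ge 1$, together with a smooth field $g$ of symmetric bilinear forms of signature $(-,+,\dots,+)$ on its tangent spaces. It is time-orientable if it admits a continuous timelike vector field; it is time-oriented if a time orientation has been chosen. A $C^\infty$-extension of $(M,g)$ is a smooth isometric embedding $\iota : M \hookrightarrow \tilde M$ into a smooth Lorentzian manifold $(\tilde M,\tilde g)$ of the same dimension such that the topological boundary $\partial\iota(M)\subseteq\tilde M$ is non-empty; $(M,g)$ is $C^\infty$-inextendible if it has no $C^\infty$-extension. Theorem A.4. Let $(M,g)$ be a connected, time-oriented, smooth Lorentzian manifold of dimension $d+1\ge 2$ that is $C^\infty$-inextendible, and let $p\in M$. Let $\iota : M\setminus\{p\}\hookrightarrow\tilde M$ be a $C^\infty$-extension of $(M\setminus\{p\},\, g|_{M\setminus\{p\}})$ into a connected smooth Lorentzian manifold $(\tilde M,\tilde g)$. Then $(\tilde M,\tilde g)$ is smoothly isometric to $(M,g)$, and $\iota$ only reinserts the removed point: there is a smooth diffeomorphism $\Phi : M\to\tilde M$ with $\Phi^*\tilde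 g=g$ and $\Phi(x)=\iota(x)$ for all $x\in M\setminus\{p\}$. -/

import Mathlib

open scoped Manifold ContDiff Bundle
open TopologicalSpace

universe u

section OpenSubmanifold

variable {d : ℕ} {M : Type*} [TopologicalSpace M]
  [ChartedSpace (EuclideanSpace ℝ (Fin (d + 1))) M]

/-- In the preferred charts the derivative of the inclusion of an open subset is the identity. -/
theorem mfderiv_opens_subtypeVal (U : Opens M) (x : U) :
    mfderiv (𝓡 (d + 1)) (𝓡 (d + 1)) (Subtype.val : U → M) x
      = ContinuousLinearMap.id ℝ (EuclideanSpace ℝ (Fin (d + 1))) := by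
  have hs : MDifferentiableAt (𝓡 (d + 1)) (𝓡 (d + 1)) (Subtype.val : U → M) x :=
    (contMDiff_subtype_val (n := 1) x).mdifferentiableAt (by simp)
  have h : writtenInExtChartAt (𝓡 (d + 1)) (𝓡 (d + 1)) x (Subtype.val : U → M)
      =ᶠ[nhds (extChartAt (𝓡 (d + 1)) x x)] id := by
    have h1 := U.chartAt_subtype_val_symm_eventuallyEq (H := EuclideanSpace ℝ (Fin (d + 1)))
      (x := x)
    have h2 := (chartAt (EuclideanSpace ℝ (Fin (d + 1))) x.val).eventually_right_inverse
      (mem_chart_target _ x.val)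
    filter_upwards [h1, h2] with y hy hy2
    have : (Subtype.val : U → M) ((chartAt (EuclideanSpace ℝ (Fin (d + 1))) x).symm y)
      = (chartAt (EuclideanSpace ℝ (Fin (d + 1))) x.val).symm y := hy.symm
    simp [writtenInExtChartAt, this, hy2]
  have h3 : fderivWithin ℝ (writtenInExtChartAt (𝓡 (d + 1)) (𝓡 (d + 1)) x (Subtype.val : U → M))
      (Set.range (𝓡 (d + 1))) (extChartAt (𝓡 (d + 1)) x x)
      = ContinuousLinearMap.id ℝ (EuclideanSpace ℝ (Fin (d + 1))) := by
    rw [ModelWithCorners.range_eq_univ, fderivWithin_univ, h.fderiv_eq, fderiv_id]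
  exact hs.mfderiv.trans h3

/-- Coordinate changes of the tangent bundle of an open subset agree with those of the manifold. -/
theorem tangent_symm_opens [IsManifold (𝓡 (d + 1)) ∞ M] (U : Opens M) (x₀ x : U)
    (hx : x ∈ (chartAt (EuclideanSpace ℝ (Fin (d + 1))) x₀).source)
    (hx' : (x : M) ∈ (chartAt (EuclideanSpace ℝ (Fin (d + 1))) (x₀ : M)).source)
    (v : EuclideanSpace ℝ (Fin (d + 1))) :
    (trivializationAt (EuclideanSpace ℝ (Fin (d + 1))) (TangentSpace (𝓡 (d + 1))) x₀).symm x v =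
      (trivializationAt (EuclideanSpace ℝ (Fin (d + 1))) (TangentSpace (𝓡 (d + 1)))
        (x₀ : M)).symm (x : M) v := by
  have h1 := DFunLike.congr_fun
    (TangentBundle.symmL_trivializationAt_eq_core (𝕜 := ℝ) (I := 𝓡 (d + 1)) hx) v
  have h2 := DFunLike.congr_fun
    (TangentBundle.symmL_trivializationAt_eq_core (𝕜 := ℝ) (I := 𝓡 (d + 1)) hx') v
  rw [Bundle.Trivialization.symmL_apply _ (by simpa using hx)] at h1
  rw [Bundle.Trivialization.symmL_apply _ (by simpa using hx')] at h2
  refine h1.trans (Eq.trans ?_ h2.symm)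
  have key : fderivWithin ℝ (extChartAt (𝓡 (d + 1)) x ∘ (extChartAt (𝓡 (d + 1)) x₀).symm)
        (Set.range (𝓡 (d + 1))) (extChartAt (𝓡 (d + 1)) x₀ x) =
      fderivWithin ℝ (extChartAt (𝓡 (d + 1)) (x : M) ∘ (extChartAt (𝓡 (d + 1)) (x₀ : M)).symm)
        (Set.range (𝓡 (d + 1))) (extChartAt (𝓡 (d + 1)) (x₀ : M) (x : M)) := by
    rw [ModelWithCorners.range_eq_univ, fderivWithin_univ, fderivWithin_univ]
    refine Filter.EventuallyEq.fderiv_eq ?_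
    have ht := (chartAt (EuclideanSpace ℝ (Fin (d + 1))) x₀).open_target.mem_nhds
      ((chartAt (EuclideanSpace ℝ (Fin (d + 1))) x₀).map_source hx)
    filter_upwards [ht] with y hy
    have := (chartAt (EuclideanSpace ℝ (Fin (d + 1))) (x₀ : M)).subtypeRestr_symm_eqOn (U := U) ⟨x₀⟩ hy
    have h3 : (Subtype.val : U → M) ((chartAt (EuclideanSpace ℝ (Fin (d + 1))) x₀).symm y)
        = (chartAt (EuclideanSpace ℝ (Fin (d + 1))) (x₀ : M)).symm y := this.symm
    simp [← h3]
    rfl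
  exact congrArg (fun L : EuclideanSpace ℝ (Fin (d + 1)) →L[ℝ] EuclideanSpace ℝ (Fin (d + 1)) ↦
    L v) key

end OpenSubmanifold

/-- A smooth Lorentzian metric on a manifold of dimension `d + 1`: a smooth field of symmetric
bilinear forms on the tangent spaces, each of signature `(-, +, …, +)`. -/
structure LorentzianMetric (d : ℕ) (M : Type*) [TopologicalSpace M]
    [ChartedSpace (EuclideanSpace ℝ (Fin (d + 1))) M] [IsManifold (𝓡 (d + 1)) ∞ M] where
  /-- The bilinear form on the tangent space at `x`. -/
  val (x : M) : TangentSpace (𝓡 (d + 1)) x →L[ℝ] TangentSpace (𝓡 (d + 1)) x →L[ℝ] ℝ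
  symm (x : M) (v w : TangentSpace (𝓡 (d + 1)) x) : val x v w = val x w v
  signature (x : M) : ∃ b : Module.Basis (Fin (d + 1)) ℝ (TangentSpace (𝓡 (d + 1)) x),
    ∀ i j, val x (b i) (b j) = if i = j then (if i = 0 then -1 else 1) else 0
  contMDiff : ContMDiff (𝓡 (d + 1))
    ((𝓡 (d + 1)).prod 𝓘(ℝ, EuclideanSpace ℝ (Fin (d + 1)) →L[ℝ]
      EuclideanSpace ℝ (Fin (d + 1)) →L[ℝ] ℝ)) ∞
    (fun x ↦ Bundle.TotalSpace.mk' (EuclideanSpace ℝ (Fin (d + 1)) →L[ℝ]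
      EuclideanSpace ℝ (Fin (d + 1)) →L[ℝ] ℝ) x (val x))

namespace LorentzianMetric

variable {d : ℕ}

section Basic

variable {M : Type*} [TopologicalSpace M]
  [ChartedSpace (EuclideanSpace ℝ (Fin (d + 1))) M] [IsManifold (𝓡 (d + 1)) ∞ M]

/-- `(M, g)` can be time-oriented: there is a continuous timelike vector field on `M`. -/
def IsTimeOrientable (g : LorentzianMetric d M) : Prop :=
  ∃ X : ∀ x : M, TangentSpace (𝓡 (d + 1)) x,
    Continuous (fun x ↦ (⟨x, X x⟩ : TangentBundle (𝓡 (d + 1)) M)) ∧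
      ∀ x, g.val x (X x) (X x) < 0

/-- The metric induced on an open subset: the pullback under the inclusion. -/
noncomputable def restrict (g : LorentzianMetric d M) (U : Opens M) : LorentzianMetric d U where
  val x := (ContinuousLinearMap.precomp ℝ
      (mfderiv (𝓡 (d + 1)) (𝓡 (d + 1)) (Subtype.val : U → M) x)).comp
    ((g.val (x : M)).comp (mfderiv (𝓡 (d + 1)) (𝓡 (d + 1)) (Subtype.val : U → M) x))
  symm x v w := g.symm _ _ _
  signature x := by
    obtain ⟨b, hb⟩ := g.signature (x : M)
    refine ⟨b, fun i j ↦ ?_⟩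
    have h (v : EuclideanSpace ℝ (Fin (d + 1))) :
        mfderiv (𝓡 (d + 1)) (𝓡 (d + 1)) (Subtype.val : U → M) x v = v := by
      rw [mfderiv_opens_subtypeVal]; rfl
    refine Eq.trans ?_ (hb i j)
    exact congrArg₂ (fun v w ↦ g.val (x : M) v w) (h _) (h _)
  contMDiff := by
    intro x₀
    rw [contMDiffAt_hom_bundle]
    refine ⟨contMDiffAt_id, ?_⟩
    have hg := ((contMDiffAt_hom_bundle _).1 (g.contMDiff (x₀ : M))).2
    refine (hg.comp x₀ contMDiff_subtype_val.contMDiffAt).congr_of_eventuallyEq ?_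
    have hU := (chartAt (EuclideanSpace ℝ (Fin (d + 1))) x₀).open_source.mem_nhds
      (mem_chart_source _ x₀)
    filter_upwards [hU] with x hx
    have hx' : (x : M) ∈ (chartAt (EuclideanSpace ℝ (Fin (d + 1))) (x₀ : M)).source := by
      rw [Opens.chartAt_eq, OpenPartialHomeomorph.subtypeRestr_source] at hx
      exact hx
    ext v w
    simp only [Function.comp_apply]
    have h (v : EuclideanSpace ℝ (Fin (d + 1))) :
        mfderiv (𝓡 (d + 1)) (𝓡 (d + 1)) (Subtype.val : U → M) x v = v := by
      rw [mfderiv_opens_subtypeVal]; rfl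
    rw [inCoordinates_apply_eq₂ (by simpa using hx) (by simpa using hx) (by simp),
      inCoordinates_apply_eq₂ (by simpa using hx') (by simpa using hx') (by simp)]
    erw [Bundle.Trivial.linearMapAt_trivialization]
    exact congrArg₂ (fun v w ↦ g.val (x : M) v w)
      ((h _).trans (tangent_symm_opens U x₀ x hx hx' v))
      ((h _).trans (tangent_symm_opens U x₀ x hx hx' w))

end Basic

section Maps

variable {M N : Type*}
  [TopologicalSpace M] [ChartedSpace (EuclideanSpace ℝ (Fin (d + 1))) M]
  [IsManifold (𝓡 (d + 1)) ∞ M]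
  [TopologicalSpace N] [ChartedSpace (EuclideanSpace ℝ (Fin (d + 1))) N]
  [IsManifold (𝓡 (d + 1)) ∞ N]

/-- The differentiable map `f : (M, g) → (N, h)` preserves the metrics: `f^* h = g`. -/
def PreservesMetric (g : LorentzianMetric d M) (h : LorentzianMetric d N) (f : M → N) : Prop :=
  ∀ (x : M) (v w : TangentSpace (𝓡 (d + 1)) x),
    h.val (f x) (mfderiv (𝓡 (d + 1)) (𝓡 (d + 1)) f x v) (mfderiv (𝓡 (d + 1)) (𝓡 (d + 1)) f x w)
      = g.val x v w

/-- `ι : M → N` is a smooth extension of `(M, g)` by the smooth Lorentzian manifold `(N, h)` of the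
same dimension: a smooth isometric embedding whose image has non-empty topological boundary. -/
structure IsExtension (g : LorentzianMetric d M) (h : LorentzianMetric d N) (ι : M → N) :
    Prop where
  isSmoothEmbedding : Manifold.IsSmoothEmbedding (𝓡 (d + 1)) (𝓡 (d + 1)) ∞ ι
  preservesMetric : PreservesMetric g h ι
  frontier_nonempty : (frontier (Set.range ι)).Nonempty

end Maps

/-- `(M, g)` is smoothly inextendible: it has no smooth extension. As manifolds are second
countable, it does not matter that the extensions live in the universe of `M`. -/
def IsInextendible {M : Type u} [TopologicalSpace M]
    [ChartedSpace (EuclideanSpace ℝ (Fin (d + 1))) M] [IsManifold (𝓡 (d + 1)) ∞ M]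
    (g : LorentzianMetric d M) : Prop :=
  ∀ (N : Type u) [TopologicalSpace N] [ChartedSpace (EuclideanSpace ℝ (Fin (d + 1))) N]
    [IsManifold (𝓡 (d + 1)) ∞ N] [T2Space N] [SecondCountableTopology N]
    (h : LorentzianMetric d N) (ι : M → N), ¬ IsExtension g h ι

end LorentzianMetric

/-- The manifold `M ∖ {p}`, as an open submanifold of `M`. -/
def puncturedAt {M : Type*} [TopologicalSpace M] [T1Space M] (p : M) : Opens M :=
  ⟨{p}ᶜ, isOpen_compl_singleton⟩

/-! The proof joins a gluing argument, a local regularity argument and a connectedness argument.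

Gluing. Suppose no point `q` of `N` is an accumulation point of `ι x` as `x → p`. Then each `q` can
be separated from `p`, so `N` with `p` glued in along `ι` (`Reinsertion`) is a Hausdorff Lorentzian
manifold. `M` embeds isometrically in it, with a frontier inherited from that of `ι`, against
inextendibility (`exists_accumulation`). So an accumulation point `q` exists; let `j` be `ι` off `p`
and `j p = q`. As `ι` is open and injective and `M` is Hausdorff, `q` is not a value of `ι`.

Regularity of `j` at `p`. In charts an isometry `f` satisfies `D²f = Df Γ - Γ'(f)(Df, Df)`, a total
differential equation for the pair `(f, Df)`. In dimension at least two, a solution on a punctured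
ball with values in a compact set is Lipschitz, hence extends over the puncture, and smoothly so
(`exists_contDiffOn_update_of_hasFDerivAt_eq`). What is needed is a bound on `Df`, which is not
automatic, since linear isometries of indefinite forms (boosts) are unbounded. By duality an upper
bound follows from a lower one (`norm_le_of_pullback_eq`). If the lower bound failed, there would be
unit vectors at points `xₙ → p`, almost annihilated by `Df`, with `f xₙ → q`. Up to sign they point
away from `p`. Their geodesics run for a uniform time and end at a distance from `p` bounded below,
while the image geodesics are so slow that they stay near `q`. A limit of the endpoints would be
sent to `q`, which is not a value (`exists_le_norm_fderiv`).

Connectedness. `j` is now an injective local isometry from `M` to `N`. By inextendibility its range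
has empty frontier, so it is clopen, hence everything (`IsInextendible.surjective`). -/

section PuncturedBall

/-! ### Calculus on punctured balls in dimension at least two -/

open Set Filter Topology Metric

variable {E : Type*} [NormedAddCommGroup E] [NormedSpace ℝ E]

/-- In dimension at least two, points not hidden behind `p` when seen from `x` are dense. -/
theorem dense_notMem_segment (hE : 1 < Module.rank ℝ E) {x p : E} (hx : x ≠ p) :
    Dense {z : E | p ∉ segment ℝ x z} := by
  -- Points hidden behind `p` lie on the line through `x` and `p`; a proper subspace has empty
  -- interior, so its translate has dense complement.
  have hs : (Submodule.span ℝ {p - x}) ≠ ⊤ := by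
    intro h
    have h1 : Module.rank ℝ (Submodule.span ℝ {p - x}) ≤ 1 := by
      simpa using rank_span_le (R := ℝ) ({p - x} : Set E)
    rw [h, rank_top] at h1
    exact absurd hE (not_lt.2 h1)
  have hd : Dense ((Submodule.span ℝ {p - x} : Submodule ℝ E) : Set E)ᶜ := by
    rw [← interior_eq_empty_iff_dense_compl, ← not_nonempty_iff_eq_empty]
    exact fun h ↦ hs (Submodule.eq_top_of_nonempty_interior' _ h)
  have hsurj : Function.Surjective fun w : E ↦ x + w := fun z ↦ ⟨z - x, by simp⟩
  have hd' := hsurj.denseRange.dense_image (by fun_prop) hd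
  refine hd'.mono ?_
  rintro _ ⟨w, hw, rfl⟩ hp
  rw [segment_eq_image'] at hp
  obtain ⟨t, -, ht⟩ := hp
  simp only [add_sub_cancel_left] at ht
  have ht0 : t ≠ 0 := by
    rintro rfl
    exact hx (by simpa using ht)
  refine hw (Submodule.mem_span_singleton.2 ⟨t⁻¹, ?_⟩)
  rw [← ht, add_sub_cancel_left, smul_smul, inv_mul_cancel₀ ht0, one_smul]

variable {X : Type*} [NormedAddCommGroup X] [NormedSpace ℝ X]

/-- A function with bounded derivative on a punctured ball of dimension at least two is
Lipschitz there. -/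
theorem norm_sub_le_of_hasFDerivAt_puncturedBall (hE : 1 < Module.rank ℝ E) {p : E} {r C : ℝ}
    {F : E → X} {F' : E → E →L[ℝ] X} (hF : ∀ x ∈ ball p r \ {p}, HasFDerivAt F (F' x) x)
    (hC : ∀ x ∈ ball p r \ {p}, ‖F' x‖ ≤ C) {x y : E} (hx : x ∈ ball p r \ {p})
    (hy : y ∈ ball p r \ {p}) : ‖F y - F x‖ ≤ C * ‖y - x‖ := by
  -- The mean value inequality applies along segments missing `p`; the remaining endpoints are
  -- limits of such ones, and the estimate is closed.
  have hseg : ∀ z ∈ ball p r \ {p}, p ∉ segment ℝ x z → ‖F z - F x‖ ≤ C * ‖z - x‖ := by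
    intro z hz hpz
    have hsub : segment ℝ x z ⊆ ball p r \ {p} := fun w hw ↦
      ⟨(convex_ball p r).segment_subset hx.1 hz.1 hw, fun h ↦ hpz (h ▸ hw)⟩
    exact (convex_segment x z).norm_image_sub_le_of_norm_hasFDerivWithin_le
      (fun w hw ↦ (hF w (hsub hw)).hasFDerivWithinAt) (fun w hw ↦ hC w (hsub hw))
      (left_mem_segment ℝ x z) (right_mem_segment ℝ x z)
  have hopen : ball p r \ {p} ∈ 𝓝 y := (isOpen_ball.sdiff isClosed_singleton).mem_nhds hy
  have hfr : ∃ᶠ z in 𝓝 y, z ∈ {z : E | p ∉ segment ℝ x z} :=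
    mem_closure_iff_frequently.1 (dense_notMem_segment hE hx.2 y)
  have hFy : ContinuousAt F y := (hF y hy).continuousAt
  by_contra hlt
  push Not at hlt
  have hev : ∀ᶠ z in 𝓝 y, C * ‖z - x‖ < ‖F z - F x‖ := by
    have h1 : ContinuousAt (fun z ↦ C * ‖z - x‖) y := by fun_prop
    have h2 : ContinuousAt (fun z ↦ ‖F z - F x‖) y := by fun_prop
    exact h1.eventually_lt h2 hlt
  obtain ⟨z, hz, hz1, hz2⟩ := (hfr.and_eventually (hev.and hopen)).exists
  exact absurd (hseg z hz2 hz) (not_le.2 hz1)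

theorem neBot_nhdsNE_of_one_lt_rank (hE : 1 < Module.rank ℝ E) (p : E) : (𝓝[≠] p).NeBot := by
  have : Nontrivial E := rank_pos_iff_nontrivial.1 (zero_lt_one.trans hE)
  exact Module.punctured_nhds_neBot ℝ E p

/-- If `F` is continuous at `p`, and its derivative off `p` converges to `L`, then `L` is the
derivative of `F` at `p`. -/
theorem hasFDerivAt_of_tendsto_punctured (hE : 1 < Module.rank ℝ E) {p : E}
    {F : E → X} {F' : E → E →L[ℝ] X} {L : E →L[ℝ] X}
    (hF : ∀ᶠ x in 𝓝[≠] p, HasFDerivAt F (F' x) x) (hp : ContinuousAt F p)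
    (hL : Tendsto F' (𝓝[≠] p) (𝓝 L)) : HasFDerivAt F L p := by
  rw [hasFDerivAt_iff_isLittleO, Asymptotics.isLittleO_iff]
  intro c hc
  have h1 : ∀ᶠ x in 𝓝[≠] p, HasFDerivAt F (F' x) x ∧ ‖F' x - L‖ ≤ c := by
    refine hF.and ?_
    filter_upwards [Metric.tendsto_nhds.1 hL c hc] with x hx
    rw [← dist_eq_norm]; exact hx.le
  rw [eventually_nhdsWithin_iff, Metric.eventually_nhds_iff_ball] at h1
  obtain ⟨r, hr, h⟩ := h1
  -- `F - L` is Lipschitz off `p` with the small constant `c`; letting one of the two points tend to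
  -- `p` gives the differentiability estimate at `p`.
  have hG : ∀ x ∈ ball p r \ {p}, HasFDerivAt (fun x ↦ F x - L x) (F' x - L) x := fun x hx ↦
    (h x hx.1 hx.2).1.sub L.hasFDerivAt
  have hne := neBot_nhdsNE_of_one_lt_rank hE p
  filter_upwards [ball_mem_nhds p hr] with x hx
  rcases eq_or_ne x p with rfl | hxp
  · simp
  have key : ∀ᶠ y in 𝓝[≠] p, ‖(F x - L x) - (F y - L y)‖ ≤ c * ‖x - y‖ := by
    filter_upwards [inter_mem_nhdsWithin {p}ᶜ (ball_mem_nhds p hr)] with y hy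
    exact norm_sub_le_of_hasFDerivAt_puncturedBall hE hG (fun z hz ↦ (h z hz.1 hz.2).2)
      ⟨hy.2, hy.1⟩ ⟨hx, hxp⟩
  have hF' : Tendsto F (𝓝[≠] p) (𝓝 (F p)) := hp.tendsto.mono_left nhdsWithin_le_nhds
  have hL' : Tendsto (fun y ↦ L y) (𝓝[≠] p) (𝓝 (L p)) :=
    (L.continuous.tendsto p).mono_left nhdsWithin_le_nhds
  have hid : Tendsto (fun y : E ↦ y) (𝓝[≠] p) (𝓝 p) := tendsto_id.mono_left nhdsWithin_le_nhds
  have := le_of_tendsto_of_tendsto ((tendsto_const_nhds (x := F x - L x)).sub (hF'.sub hL')).norm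
    (((tendsto_const_nhds (x := x)).sub hid).norm.const_mul c) key
  rwa [map_sub, sub_sub_sub_comm]

/-- Regularity of solutions of the total differential equation `DZ = Θ(x, Z)`. -/
theorem contDiffOn_of_hasFDerivAt_eq {B : Set E} (hB : IsOpen B) {W : Set (E × X)}
    {Θ : E × X → E →L[ℝ] X} (hΘ : ContDiffOn ℝ ∞ Θ W) {Z : E → X}
    (hW : ∀ x ∈ B, (x, Z x) ∈ W) (hZ : ∀ x ∈ B, HasFDerivAt Z (Θ (x, Z x)) x) :
    ContDiffOn ℝ ∞ Z B := by
  rw [contDiffOn_infty]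
  intro n
  -- Bootstrapping: if `Z` is `C^n`, so is `DZ = Θ(x, Z)`, hence `Z` is `C^(n+1)`.
  induction n with
  | zero => exact contDiffOn_zero.2 fun x hx ↦ (hZ x hx).continuousAt.continuousWithinAt
  | succ n ih =>
    push_cast
    rw [contDiffOn_succ_iff_fderiv_of_isOpen hB]
    refine ⟨fun x hx ↦ (hZ x hx).differentiableAt.differentiableWithinAt, by simp, ?_⟩
    have : ContDiffOn ℝ n (fun x ↦ Θ (x, Z x)) B :=
      (hΘ.of_le (by exact_mod_cast le_top)).comp (contDiffOn_id.prodMk ih) hW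
    exact this.congr fun x hx ↦ (hZ x hx).fderiv

/-- Solutions of the total differential equation `DZ = Θ(x, Z)` on a punctured ball which stay in a
compact set extend smoothly over the puncture. -/
theorem exists_contDiffOn_update_of_hasFDerivAt_eq [CompleteSpace X] [FiniteDimensional ℝ E]
    [DecidableEq E]
    (hE : 1 < Module.rank ℝ E) {p : E}
    {r : ℝ} (hr : 0 < r) {W : Set (E × X)} (hWo : IsOpen W) {Θ : E × X → E →L[ℝ] X}
    (hΘ : ContDiffOn ℝ ∞ Θ W)
    {K : Set X} (hK : IsCompact K) (hKW : closedBall p r ×ˢ K ⊆ W) {Z : E → X}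
    (hZK : ∀ x ∈ ball p r \ {p}, Z x ∈ K)
    (hZ : ∀ x ∈ ball p r \ {p}, HasFDerivAt Z (Θ (x, Z x)) x) :
    ∃ z ∈ K, Tendsto Z (𝓝[≠] p) (𝓝 z) ∧ ContDiffOn ℝ ∞ (Function.update Z p z) (ball p r) ∧
      ∀ x ∈ ball p r, HasFDerivAt (Function.update Z p z)
        (Θ (x, Function.update Z p z x)) x := by
  obtain ⟨C, hC⟩ := ((isCompact_closedBall p r).prod hK).exists_bound_of_continuousOn
    (hΘ.continuousOn.mono hKW)
  have hne := neBot_nhdsNE_of_one_lt_rank hE p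
  have hB : ball p r \ {p} ∈ 𝓝[≠] p := by
    rw [sdiff_eq, inter_comm]; exact inter_mem_nhdsWithin _ (ball_mem_nhds p hr)
  -- `Θ` is bounded on the compact set where `(x, Z x)` lives, so `Z` is Lipschitz and has a limit
  -- at `p` by completeness.
  have hlip : LipschitzOnWith C.toNNReal Z (ball p r \ {p}) := by
    refine LipschitzOnWith.of_dist_le_mul fun x hx y hy ↦ ?_
    rw [dist_eq_norm, dist_eq_norm]
    refine (norm_sub_le_of_hasFDerivAt_puncturedBall hE hZ
      (fun x hx ↦ hC _ ⟨ball_subset_closedBall hx.1, hZK x hx⟩) hy hx).trans ?_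
    gcongr
    exact Real.le_coe_toNNReal C
  have hcau : Cauchy (map Z (𝓝[≠] p)) := by
    refine (cauchy_nhds.mono nhdsWithin_le_nhds).map_of_le hlip.uniformContinuousOn ?_
    exact le_principal_iff.2 hB
  obtain ⟨z, hz⟩ := CompleteSpace.complete hcau
  have hz : Tendsto Z (𝓝[≠] p) (𝓝 z) := hz
  have hzK : z ∈ K := hK.isClosed.mem_of_tendsto hz (by filter_upwards [hB] with x hx using hZK x hx)
  have hoff : ∀ x ∈ ball p r \ {p}, HasFDerivAt (Function.update Z p z) (Θ (x, Z x)) x := by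
    intro x hx
    refine (hZ x hx).congr_of_eventuallyEq ?_
    filter_upwards [isOpen_compl_singleton.mem_nhds hx.2] with y hy
    exact Function.update_of_ne hy _ _
  have hpW : (p, z) ∈ W := hKW ⟨mem_closedBall_self hr.le, hzK⟩
  have hat : HasFDerivAt (Function.update Z p z) (Θ (p, z)) p := by
    refine hasFDerivAt_of_tendsto_punctured hE (F' := fun x ↦ Θ (x, Z x)) ?_
      (continuousAt_update_same.2 hz) ?_
    · filter_upwards [hB] with x hx using hoff x hx
    · exact ((hΘ.continuousOn.continuousAt (hWo.mem_nhds hpW)).tendsto).comp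
        ((tendsto_id.mono_left nhdsWithin_le_nhds).prodMk_nhds hz)
  have hall : ∀ x ∈ ball p r, HasFDerivAt (Function.update Z p z)
      (Θ (x, Function.update Z p z x)) x := by
    intro x hx
    rcases eq_or_ne x p with rfl | hxp
    · simpa using hat
    · simpa [hxp] using hoff x ⟨hx, hxp⟩
  refine ⟨z, hzK, hz, contDiffOn_of_hasFDerivAt_eq isOpen_ball hΘ (fun x hx ↦ ?_) hall, hall⟩
  refine hKW ⟨ball_subset_closedBall hx, ?_⟩
  rcases eq_or_ne x p with rfl | hxp
  · simpa using hzK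
  · simpa [hxp] using hZK x ⟨hx, hxp⟩

end PuncturedBall

/-! ### Curves confined to coordinate balls -/

section ChartCurves

open Set Filter Topology Metric

variable {E : Type*} [NormedAddCommGroup E] {N : Type*} [TopologicalSpace N]

/-- Preimages of compact subsets of the target of a chart are closed. -/
theorem OpenPartialHomeomorph.isClosed_symm_image [T2Space N] (φ : OpenPartialHomeomorph N E)
    {K : Set E} (hK : IsCompact K) (hKt : K ⊆ φ.target) : IsClosed (φ.symm '' K) :=
  (hK.image_of_continuousOn (φ.continuousOn_symm.mono hKt)).isClosed

theorem OpenPartialHomeomorph.mem_symm_image_iff (φ : OpenPartialHomeomorph N E)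
    {K : Set E} (hKt : K ⊆ φ.target) {y : N} : y ∈ φ.symm '' K ↔ y ∈ φ.source ∧ φ y ∈ K := by
  constructor
  · rintro ⟨e, he, rfl⟩
    exact ⟨φ.map_target (hKt he), by rwa [φ.right_inv (hKt he)]⟩
  · rintro ⟨h1, h2⟩
    exact ⟨_, h2, φ.left_inv h1⟩

/-- A curve which starts in a closed coordinate ball, and is in the open coordinate ball as long as
it has not left the closed one, stays in the closed ball. -/
theorem OpenPartialHomeomorph.forall_mem_of_continuousOn_Icc [T2Space N] [ProperSpace E]
    (φ : OpenPartialHomeomorph N E)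
    {q : E} {s T : ℝ} (hs : closedBall q s ⊆ φ.target) {κ : ℝ → N}
    (hκ : ContinuousOn κ (Icc 0 T)) (h0 : κ 0 ∈ φ.symm '' closedBall q s)
    (h : ∀ t ∈ Ico 0 T, (∀ τ ∈ Icc 0 t, κ τ ∈ φ.symm '' closedBall q s) → φ (κ t) ∈ ball q s) :
    ∀ t ∈ Icc 0 T, κ t ∈ φ.symm '' closedBall q s := by
  have hcl := φ.isClosed_symm_image (isCompact_closedBall q s) hs
  refine IsClosed.Icc_subset_of_forall_mem_nhdsGT_of_Icc_subset
    (s := {t | κ t ∈ φ.symm '' closedBall q s}) ?_ h0 ?_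
  · rw [inter_comm]
    exact hκ.preimage_isClosed_of_isClosed isClosed_Icc hcl
  · intro t ht hsub
    have hb := h t ht fun τ hτ ↦ hsub hτ
    have hsrc : κ t ∈ φ.source := ((φ.mem_symm_image_iff hs).1 (hsub ⟨ht.1, le_rfl⟩)).1
    have hnhds : φ.source ∩ φ ⁻¹' ball q s ∈ 𝓝 (κ t) :=
      (φ.isOpen_inter_preimage isOpen_ball).mem_nhds ⟨hsrc, hb⟩
    have hc : Tendsto κ (𝓝[>] t) (𝓝 (κ t)) := by
      refine (hκ t ⟨ht.1, ht.2.le⟩).mono_left ?_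
      rw [← nhdsWithin_Ioo_eq_nhdsGT ht.2]
      exact nhdsWithin_mono _ fun τ hτ ↦ ⟨ht.1.trans hτ.1.le, hτ.2.le⟩
    filter_upwards [hc hnhds] with τ hτ
    exact (φ.mem_symm_image_iff hs).2 ⟨hτ.1, ball_subset_closedBall hτ.2⟩

end ChartCurves

/-! ### Christoffel symbols and the second derivative of an isometry -/

section Christoffel

set_option maxSynthPendingDepth 3

open Set Filter Topology Metric

variable {E : Type*} [NormedAddCommGroup E] [NormedSpace ℝ E]

/-- `Γ` is the Christoffel symbol at `x` of the field `G` of symmetric bilinear forms. -/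
def IsChristoffelAt (G : E → E →L[ℝ] E →L[ℝ] ℝ) (x : E) (Γ : E →L[ℝ] E →L[ℝ] E) : Prop :=
  ∀ u v w, 2 * G x (Γ u v) w = fderiv ℝ G x u v w + fderiv ℝ G x v u w - fderiv ℝ G x w u v

/-- The right-hand side of the Koszul formula is the trilinear form `K`, built from `fderiv ℝ G` by
permuting arguments; nondegeneracy solves for `Γ`, and inversion of operators is smooth. -/
theorem exists_isChristoffelAt [CompleteSpace E] {O : Set E} (hO : IsOpen O)
    {G : E → E →L[ℝ] E →L[ℝ] ℝ}
    (hG : ContDiffOn ℝ ∞ G O) (hinv : ∀ x ∈ O, (G x).IsInvertible) :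
    ∃ Γ : E → E →L[ℝ] E →L[ℝ] E, ContDiffOn ℝ ∞ Γ O ∧ ∀ x ∈ O, IsChristoffelAt G x (Γ x) := by
  let fl := (ContinuousLinearMap.flipₗᵢ ℝ E E (E →L[ℝ] ℝ)).toContinuousLinearEquiv.toContinuousLinearMap
  let fl' := (ContinuousLinearMap.flipₗᵢ ℝ E E ℝ).toContinuousLinearEquiv.toContinuousLinearMap
  let K : E → E →L[ℝ] E →L[ℝ] E →L[ℝ] ℝ := fun x ↦
    fderiv ℝ G x + fl (fderiv ℝ G x) - fl'.comp (fl (fderiv ℝ G x))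
  have hD : ContDiffOn ℝ ∞ (fderiv ℝ G) O := hG.fderiv_of_isOpen hO (by simp)
  have hD' : ContDiffOn ℝ ∞ (fun x ↦ fl (fderiv ℝ G x)) O := fl.contDiff.comp_contDiffOn hD
  have hK : ContDiffOn ℝ ∞ K O :=
    (hD.add hD').sub (contDiffOn_const.clm_comp hD')
  have hI : ContDiffOn ℝ ∞ (fun x ↦ (G x).inverse) O := fun x hx ↦
    ((hinv x hx).contDiffAt_map_inverse).comp_contDiffWithinAt x (hG x hx)
  refine ⟨fun x ↦ (2⁻¹ : ℝ) • (ContinuousLinearMap.compL ℝ E (E →L[ℝ] ℝ) E (G x).inverse).comp (K x),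
    contDiffOn_const.fun_smul (((ContinuousLinearMap.compL ℝ E (E →L[ℝ] ℝ) E).contDiff.comp_contDiffOn
      hI).clm_comp hK), fun x hx u v w ↦ ?_⟩
  obtain ⟨e, he⟩ := hinv x hx
  have : G x ((G x).inverse (K x u v)) = K x u v := by
    rw [← he, ContinuousLinearMap.inverse_equiv]; simp
  simp only [smul_apply, ContinuousLinearMap.comp_apply,
    ContinuousLinearMap.compL_apply, map_smul, this, smul_eq_mul]
  simp [K, fl, fl']

theorem injective_of_pullback_eq {A : E →L[ℝ] E} {G H : E →L[ℝ] E →L[ℝ] ℝ}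
    (hG : Function.Injective G) (h : ∀ v w, H (A v) (A w) = G v w) : Function.Injective A := by
  rw [injective_iff_map_eq_zero]
  intro v hv
  refine (injective_iff_map_eq_zero _).1 hG v ?_
  ext w
  rw [← h, hv]
  simp

theorem surjective_of_pullback_eq [FiniteDimensional ℝ E] {A : E →L[ℝ] E}
    {G H : E →L[ℝ] E →L[ℝ] ℝ}
    (hG : Function.Injective G) (h : ∀ v w, H (A v) (A w) = G v w) : Function.Surjective A :=
  (LinearMap.injective_iff_surjective (f := (A : E →ₗ[ℝ] E))).1 (injective_of_pullback_eq hG h)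

theorem isInvertible_of_injective [FiniteDimensional ℝ E] {G : E →L[ℝ] E →L[ℝ] ℝ}
    (hG : Function.Injective G) : G.IsInvertible := by
  have hrank : Module.finrank ℝ E = Module.finrank ℝ (E →L[ℝ] ℝ) := by
    rw [← LinearEquiv.finrank_eq (LinearMap.toContinuousLinearMap (𝕜 := ℝ) (E := E) (F' := ℝ))]
    exact (Subspace.dual_finrank_eq).symm
  refine ⟨(LinearEquiv.ofInjectiveOfFinrankEq (G : E →ₗ[ℝ] (E →L[ℝ] ℝ))
    hG hrank).toContinuousLinearEquiv, ?_⟩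
  ext v w
  rfl

/-- An isometry is affine: its second derivative is determined by the first one. -/
theorem fderiv_fderiv_of_isometry [FiniteDimensional ℝ E] {f : E → E} {x : E}
    {G H : E → E →L[ℝ] E →L[ℝ] ℝ}
    {Γ Γ' : E →L[ℝ] E →L[ℝ] E} (hf : ContDiffAt ℝ 2 f x) (hG : DifferentiableAt ℝ G x)
    (hH : DifferentiableAt ℝ H (f x)) (hGi : Function.Injective (G x))
    (hHi : Function.Injective (H (f x))) (hHs : ∀ v w, H (f x) v w = H (f x) w v)
    (hiso : ∀ᶠ y in 𝓝 x, ∀ v w, H (f y) (fderiv ℝ f y v) (fderiv ℝ f y w) = G y v w)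
    (hΓ : IsChristoffelAt G x Γ) (hΓ' : IsChristoffelAt H (f x) Γ') (u v : E) :
    fderiv ℝ (fderiv ℝ f) x u v =
      fderiv ℝ f x (Γ u v) - Γ' (fderiv ℝ f x u) (fderiv ℝ f x v) := by
  have hf1 : HasFDerivAt f (fderiv ℝ f x) x := (hf.differentiableAt (by simp)).hasFDerivAt
  have hf2 : HasFDerivAt (fderiv ℝ f) (fderiv ℝ (fderiv ℝ f) x) x :=
    ((hf.fderiv_right (m := 1) (by norm_num)).differentiableAt (by simp)).hasFDerivAt
  have hsym : ∀ u v, fderiv ℝ (fderiv ℝ f) x u v = fderiv ℝ (fderiv ℝ f) x v u := fun u v ↦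
    second_derivative_symmetric_of_eventually
      (by
        filter_upwards [hf.eventually (by simp)] with y hy
        exact (hy.differentiableAt (by simp)).hasFDerivAt) hf2 u v
  set A := fderiv ℝ f x with hA
  set B := fderiv ℝ (fderiv ℝ f) x with hB
  have hiso0 := hiso.self_of_nhds
  rw [← hA] at hiso0
  -- The isometry relation differentiated in the direction `u`.
  have key : ∀ u v w, fderiv ℝ G x u v w =
      fderiv ℝ H (f x) (A u) (A v) (A w) + H (f x) (B u v) (A w) + H (f x) (A v) (B u w) := by
    intro u v w
    have h1 : HasFDerivAt (fun y ↦ G y v w) _ x :=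
      (hG.hasFDerivAt.clm_apply (hasFDerivAt_const v x)).clm_apply (hasFDerivAt_const w x)
    have h2 : HasFDerivAt (fun y ↦ H (f y) (fderiv ℝ f y v) (fderiv ℝ f y w)) _ x :=
      ((hH.hasFDerivAt.comp x hf1).clm_apply (hf2.clm_apply (hasFDerivAt_const v x))).clm_apply
        (hf2.clm_apply (hasFDerivAt_const w x))
    have h3 := h1.congr_of_eventuallyEq
      (f₁ := fun y ↦ H (f y) (fderiv ℝ f y v) (fderiv ℝ f y w)) (by
        filter_upwards [hiso] with y hy using hy v w)
    have h4 := DFunLike.congr_fun (h3.unique h2) u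
    simp at h4
    rw [h4]
    ring
  have hA' : Function.Surjective A := surjective_of_pullback_eq hGi hiso0
  rw [eq_sub_iff_add_eq]
  refine hHi ?_
  ext w'
  obtain ⟨w, rfl⟩ := hA' w'
  -- In the cyclic combination of the three instances of `key`, the symmetry of `B` and of `H`
  -- cancels all second-derivative terms except twice `H (B u v) (A w)`.
  have e1 := hΓ u v w
  rw [key, key, key, ← hiso0] at e1
  have e2 := hΓ' (A u) (A v) (A w)
  have e3 := hHs (A u) (B v w)
  have e4 := hHs (A v) (B u w)
  rw [hsym w u, hsym w v, hsym v u] at e1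
  simp only [map_add, add_apply]
  linarith

/-- A linear isometry between two bounded, uniformly nondegenerate forms is bounded in terms of its
lower bound. -/
theorem norm_le_of_pullback_eq [FiniteDimensional ℝ E] {A : E →L[ℝ] E}
    {G H : E →L[ℝ] E →L[ℝ] ℝ} {C δ : ℝ} (hδ : 0 < δ)
    (hG : Function.Injective G) (hGC : ‖G‖ ≤ C) (hH : H.IsInvertible) (hHC : ‖H.inverse‖ ≤ C)
    (h : ∀ v w, H (A v) (A w) = G v w) (hA : ∀ v, δ * ‖v‖ ≤ ‖A v‖) : ‖A‖ ≤ C * C / δ := by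
  have hC : 0 ≤ C := (norm_nonneg _).trans hGC
  refine A.opNorm_le_bound (by positivity) fun w ↦ ?_
  -- `ψ` norms `A w`. Representing it as `H (A v)` turns `‖A w‖` into `G v w`, and the lower bound
  -- on `A` controls `‖v‖`.
  obtain ⟨ψ, hψ, hψA⟩ := exists_dual_vector'' ℝ (A w)
  obtain ⟨v, hv⟩ := surjective_of_pullback_eq hG h (H.inverse ψ)
  have h1 : H (A v) = ψ := by
    obtain ⟨e, rfl⟩ := hH
    rw [hv, ContinuousLinearMap.inverse_equiv]; simp
  have h2 : ‖A v‖ ≤ C := by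
    rw [hv]
    calc ‖H.inverse ψ‖ ≤ ‖H.inverse‖ * ‖ψ‖ := H.inverse.le_opNorm ψ
      _ ≤ C * 1 := by gcongr
      _ = C := mul_one C
  have h3 : ‖v‖ ≤ C / δ := by
    rw [le_div_iff₀ hδ, mul_comm]
    exact (hA v).trans h2
  calc ‖A w‖ = H (A v) (A w) := by rw [h1, hψA]; rfl
    _ = G v w := h v w
    _ ≤ ‖G v w‖ := Real.le_norm_self _
    _ ≤ ‖G‖ * ‖v‖ * ‖w‖ := G.le_opNorm₂ v w
    _ ≤ C * (C / δ) * ‖w‖ := by gcongr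
    _ = C * C / δ * ‖w‖ := by ring

end Christoffel

/-! ### Integral curves with a uniform time of existence -/

section IntegralCurve

open Set Filter Topology Metric

variable {F : Type*} [NormedAddCommGroup F] [NormedSpace ℝ F] [CompleteSpace F]

/-- Integral curves starting near a point exist for a uniform time, and stay near that point. -/
theorem ContDiffAt.exists_forall_mem_Icc_hasDerivAt {X : F → F} {z₀ : F} (hX : ContDiffAt ℝ 1 X z₀)
    {U : Set F} (hU : U ∈ 𝓝 z₀) :
    ∃ ε > (0 : ℝ), ∀ᶠ z in 𝓝 z₀, ∃ α : ℝ → F, α 0 = z ∧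
      ∀ t ∈ Icc 0 ε, α t ∈ U ∧ HasDerivAt α (X (α t)) t := by
  obtain ⟨ε, hε, a, r, L, K, hr, hpl⟩ := IsPicardLindelof.of_contDiffAt_one hX
  obtain ⟨α, hα, hcont⟩ :=
    (hpl 0).exists_forall_mem_closedBall_eq_hasDerivWithinAt_continuousOn
  have hr' : (0 : ℝ) < r := hr
  have hnh : closedBall z₀ (r : ℝ) ×ˢ Icc (0 - ε) (0 + ε) ∈ 𝓝 (z₀, (0 : ℝ)) :=
    prod_mem_nhds (closedBall_mem_nhds _ hr') (Icc_mem_nhds (by linarith) (by linarith))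
  have h0 : α (z₀, 0) = z₀ := (hα z₀ (mem_closedBall_self hr'.le)).1
  have hev := (hcont.continuousAt hnh).eventually (by rw [h0]; exact hU)
  rw [nhds_prod_eq] at hev
  obtain ⟨P, hP, Q, hQ, hPQ⟩ := eventually_prod_iff.1 hev
  obtain ⟨τ, hτ, hQτ⟩ := Metric.eventually_nhds_iff.1 hQ
  -- Halving `ε` keeps times interior, where one-sided derivatives are two-sided; halving `τ` gives
  -- the strict inequality under which joint continuity of the flow keeps curves in `U`.
  refine ⟨min (ε / 2) (τ / 2), by positivity, ?_⟩
  filter_upwards [hP, closedBall_mem_nhds z₀ hr'] with z hz hzr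
  refine ⟨fun t ↦ α (z, t), (hα z hzr).1, fun t ht ↦ ?_⟩
  have ht1 : t ≤ ε / 2 := ht.2.trans (min_le_left _ _)
  have ht2 : t ≤ τ / 2 := ht.2.trans (min_le_right _ _)
  refine ⟨hPQ hz (hQτ ?_), ?_⟩
  · rw [Real.dist_eq, sub_zero, abs_of_nonneg ht.1]; linarith
  · exact ((hα z hzr).2 t ⟨by linarith [ht.1], by linarith⟩).hasDerivAt
      (Icc_mem_nhds (by linarith [ht.1]) (by linarith))

end IntegralCurve

/-! ### Images of geodesics under an isometry defined off a point -/

section PuncturedIsometry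

set_option maxSynthPendingDepth 3

open Set Filter Topology Metric

/-- `k` is an isometry from a punctured coordinate neighbourhood `O ∖ {p}` with metric `G` to a
topological space, expressed in a chart `φ` in which the metric is `H`. -/
structure IsPuncturedIsometry {E : Type*} [NormedAddCommGroup E] [NormedSpace ℝ E] {N : Type*}
    [TopologicalSpace N] (O : Set E) (p : E) (G : E → E →L[ℝ] E →L[ℝ] ℝ)
    (φ : OpenPartialHomeomorph N E) (H : E → E →L[ℝ] E →L[ℝ] ℝ) (k : E → N) : Prop where
  isOpen : IsOpen O
  mem : p ∈ O
  contDiffOn_left : ContDiffOn ℝ ∞ G O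
  isInvertible_left : ∀ x ∈ O, (G x).IsInvertible
  contDiffOn_right : ContDiffOn ℝ ∞ H φ.target
  isInvertible_right : ∀ y ∈ φ.target, (H y).IsInvertible
  symm_right : ∀ y ∈ φ.target, ∀ v w, H y v w = H y w v
  continuousOn : ContinuousOn k (O \ {p})
  contDiffAt : ∀ x ∈ O \ {p}, k x ∈ φ.source → ContDiffAt ℝ ∞ (φ ∘ k) x
  pullback_eq : ∀ x ∈ O \ {p}, k x ∈ φ.source → ∀ v w,
    H (φ (k x)) (fderiv ℝ (φ ∘ k) x v) (fderiv ℝ (φ ∘ k) x w) = G x v w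

namespace IsPuncturedIsometry

variable {E : Type*} [NormedAddCommGroup E] [InnerProductSpace ℝ E]
  {N : Type*} [TopologicalSpace N] {O : Set E} {p : E} {G : E → E →L[ℝ] E →L[ℝ] ℝ}
  {φ : OpenPartialHomeomorph N E} {H : E → E →L[ℝ] E →L[ℝ] ℝ} {k : E → N}
  {Γ Γ' : E → E →L[ℝ] E →L[ℝ] E}

theorem isOpen_diff (h : IsPuncturedIsometry O p G φ H k) : IsOpen (O \ {p}) :=
  h.isOpen.sdiff isClosed_singleton

theorem continuousAt (h : IsPuncturedIsometry O p G φ H k) {x : E} (hx : x ∈ O \ {p}) :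
    ContinuousAt k x :=
  h.continuousOn.continuousAt (h.isOpen_diff.mem_nhds hx)

theorem hasFDerivAt (h : IsPuncturedIsometry O p G φ H k) {x : E} (hx : x ∈ O \ {p})
    (hk : k x ∈ φ.source) : HasFDerivAt (φ ∘ k) (fderiv ℝ (φ ∘ k) x) x :=
  ((h.contDiffAt x hx hk).differentiableAt (by simp)).hasFDerivAt

theorem hasFDerivAt_fderiv (h : IsPuncturedIsometry O p G φ H k) {x : E} (hx : x ∈ O \ {p})
    (hk : k x ∈ φ.source) :
    HasFDerivAt (fderiv ℝ (φ ∘ k)) (fderiv ℝ (fderiv ℝ (φ ∘ k)) x) x :=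
  (((h.contDiffAt x hx hk).fderiv_right (m := 1)
    (one_add_one_eq_two.trans_le ENat.LEInfty.out)).differentiableAt
    (by simp)).hasFDerivAt

theorem eventually_mem (h : IsPuncturedIsometry O p G φ H k) {x : E} (hx : x ∈ O \ {p})
    (hk : k x ∈ φ.source) : ∀ᶠ y in 𝓝 x, y ∈ O \ {p} ∧ k y ∈ φ.source :=
  (h.isOpen_diff.eventually_mem hx).and ((h.continuousAt hx).preimage_mem_nhds
    (φ.open_source.mem_nhds hk))

theorem fderiv_fderiv [FiniteDimensional ℝ E] (h : IsPuncturedIsometry O p G φ H k)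
    (hΓ : ∀ x ∈ O, IsChristoffelAt G x (Γ x))
    (hΓ' : ∀ y ∈ φ.target, IsChristoffelAt H y (Γ' y)) {x : E} (hx : x ∈ O \ {p})
    (hk : k x ∈ φ.source) (u v : E) : fderiv ℝ (fderiv ℝ (φ ∘ k)) x u v =
      fderiv ℝ (φ ∘ k) x (Γ x u v) -
        Γ' (φ (k x)) (fderiv ℝ (φ ∘ k) x u) (fderiv ℝ (φ ∘ k) x v) := by
  have ht := φ.map_source hk
  refine fderiv_fderiv_of_isometry ((h.contDiffAt x hx hk).of_le ENat.LEInfty.out)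
    ((h.contDiffOn_left.contDiffAt (h.isOpen.mem_nhds hx.1)).differentiableAt (by simp))
    ((h.contDiffOn_right.contDiffAt (φ.open_target.mem_nhds ht)).differentiableAt (by simp))
    (h.isInvertible_left x hx.1).injective (h.isInvertible_right _ ht).injective
    (h.symm_right _ ht) ?_ (hΓ x hx.1) (hΓ' _ ht) u v
  filter_upwards [h.eventually_mem hx hk] with y hy using h.pullback_eq y hy.1 hy.2

/-- The velocity of the image of a geodesic satisfies the geodesic equation. -/
theorem hasDerivAt_image_geodesic [FiniteDimensional ℝ E] (h : IsPuncturedIsometry O p G φ H k)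
    (hΓ : ∀ x ∈ O, IsChristoffelAt G x (Γ x))
    (hΓ' : ∀ y ∈ φ.target, IsChristoffelAt H y (Γ' y)) {x w : ℝ → E} {t : ℝ}
    (hxO : x t ∈ O \ {p}) (hk : k (x t) ∈ φ.source) (hx : HasDerivAt x (w t) t)
    (hw : HasDerivAt w (-Γ (x t) (w t) (w t)) t) :
    HasDerivAt (fun t ↦ φ (k (x t))) (fderiv ℝ (φ ∘ k) (x t) (w t)) t ∧
      HasDerivAt (fun t ↦ fderiv ℝ (φ ∘ k) (x t) (w t))
        (-Γ' (φ (k (x t))) (fderiv ℝ (φ ∘ k) (x t) (w t)) (fderiv ℝ (φ ∘ k) (x t) (w t))) t := by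
  refine ⟨(h.hasFDerivAt hxO hk).comp_hasDerivAt t hx, ?_⟩
  have h1 : HasDerivAt (fun t ↦ fderiv ℝ (φ ∘ k) (x t))
      (fderiv ℝ (fderiv ℝ (φ ∘ k)) (x t) (w t)) t :=
    (h.hasFDerivAt_fderiv hxO hk).comp_hasDerivAt t hx
  have h2 := h1.clm_apply hw
  rw [h.fderiv_fderiv hΓ hΓ' hxO hk, map_neg] at h2
  refine h2.congr_deriv ?_
  abel

/-- The image velocity `u` satisfies `u' = -Γ'(u, u)`, so a small initial speed can at most double
within time `ε`. The conclusion assumes that the image is still in the coordinate ball;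
`image_geodesic` removes this assumption. -/
theorem norm_image_geodesic_sub_le [FiniteDimensional ℝ E] (h : IsPuncturedIsometry O p G φ H k)
    (hΓ : ∀ x ∈ O, IsChristoffelAt G x (Γ x))
    (hΓ' : ∀ y ∈ φ.target, IsChristoffelAt H y (Γ' y)) {q : E} {s C ε δ : ℝ}
    (hC : ∀ y ∈ closedBall q s, ‖Γ' y‖ ≤ C) (hε : 0 < ε)
    (hδ : 0 < δ) (hCδ : 4 * C * δ * ε < 1) {x w : ℝ → E}
    (h0δ : ‖fderiv ℝ (φ ∘ k) (x 0) (w 0)‖ ≤ δ) {T : ℝ} (hT : T ∈ Icc 0 ε)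
    (hα : ∀ t ∈ Icc 0 T, x t ∈ O \ {p} ∧ HasDerivAt x (w t) t ∧
      HasDerivAt w (-Γ (x t) (w t) (w t)) t)
    (hτ : ∀ τ ∈ Icc 0 T, k (x τ) ∈ φ.source ∧ φ (k (x τ)) ∈ closedBall q s) :
    ‖φ (k (x T)) - φ (k (x 0))‖ ≤ 2 * δ * T := by
  have hcu (t) (ht : t ∈ Icc 0 T) := h.hasDerivAt_image_geodesic hΓ hΓ' (hα t ht).1 (hτ t ht).1
    (hα t ht).2.1 (hα t ht).2.2
  have hlin : ∀ t ∈ Icc 0 T, δ + δ / ε * t ≤ 2 * δ := by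
    intro t ht
    have : δ / ε * t ≤ δ / ε * ε := by gcongr; exact ht.2.trans hT.2
    rw [div_mul_cancel₀ _ hε.ne'] at this
    linarith
  -- Barrier argument: where the speed meets `δ + δ / ε * t ≤ 2 * δ`, its growth is at most `4 * C *
  -- δ ^ 2`, below the slope `δ / ε` of the barrier.
  have hbound : ∀ t ∈ Icc 0 T, ‖fderiv ℝ (φ ∘ k) (x t) (w t)‖ ≤ δ + δ / ε * t := by
    refine image_norm_le_of_norm_deriv_right_lt_deriv_boundary'
      (fun t ht ↦ (hcu t ht).2.continuousAt.continuousWithinAt)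
      (fun t ht ↦ (hcu t ⟨ht.1, ht.2.le⟩).2.hasDerivWithinAt) (by simpa using h0δ) (by fun_prop)
      (B' := fun _ ↦ δ / ε) (fun t _ ↦ ?_) ?_
    · simpa using (((hasDerivAt_id t).const_mul (δ / ε)).const_add δ).hasDerivWithinAt
    · intro t ht hnorm
      have ht' : t ∈ Icc 0 T := ⟨ht.1, ht.2.le⟩
      have h2 : ‖fderiv ℝ (φ ∘ k) (x t) (w t)‖ ≤ 2 * δ := hnorm.trans_le (hlin t ht')
      have hC' := hC _ (hτ t ht').2
      have hC0 : 0 ≤ C := (norm_nonneg _).trans hC'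
      rw [norm_neg]
      refine ((Γ' _).le_opNorm₂ _ _).trans_lt ?_
      calc _ ≤ C * (2 * δ) * (2 * δ) := by gcongr
        _ = (4 * C * δ * ε) * (δ / ε) := by field_simp; ring
        _ < 1 * (δ / ε) := by gcongr
        _ = δ / ε := one_mul _
  have := norm_image_sub_le_of_norm_deriv_le_segment' (C := 2 * δ)
    (fun t ht ↦ (hcu t ht).1.hasDerivWithinAt)
    (fun t ht ↦ (hbound t ⟨ht.1, ht.2.le⟩).trans (hlin t ⟨ht.1, ht.2.le⟩)) T ⟨hT.1, le_rfl⟩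
  simpa using this

/-- The image of a geodesic with small initial velocity stays in a coordinate ball. -/
theorem image_geodesic [T2Space N] [FiniteDimensional ℝ E]
    (h : IsPuncturedIsometry O p G φ H k)
    (hΓ : ∀ x ∈ O, IsChristoffelAt G x (Γ x))
    (hΓ' : ∀ y ∈ φ.target, IsChristoffelAt H y (Γ' y)) {q : E} {s C ε δ : ℝ}
    (hs : closedBall q s ⊆ φ.target) (hC : ∀ y ∈ closedBall q s, ‖Γ' y‖ ≤ C) (hε : 0 < ε)
    (hδ : 0 < δ) (hCδ : 4 * C * δ * ε < 1) (hδs : 2 * δ * ε < s / 2) {α : ℝ → E × E}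
    (hα : ∀ t ∈ Icc 0 ε, (α t).1 ∈ O \ {p} ∧
      HasDerivAt α ((α t).2, -Γ (α t).1 (α t).2 (α t).2) t)
    (h0 : k (α 0).1 ∈ φ.source) (h0' : φ (k (α 0).1) ∈ closedBall q (s / 2))
    (h0δ : ‖fderiv ℝ (φ ∘ k) (α 0).1 (α 0).2‖ ≤ δ) :
    k (α ε).1 ∈ φ.source ∧ ‖φ (k (α ε).1) - φ (k (α 0).1)‖ ≤ 2 * δ * ε := by
  set V := φ.symm '' closedBall q s with hV
  have hs0 : 0 < s := by
    have : 0 < 2 * δ * ε := by positivity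
    linarith
  have hx (t) (ht : t ∈ Icc 0 ε) : HasDerivAt (fun t ↦ (α t).1) (α t).2 t := (hα t ht).2.fst
  have hw (t) (ht : t ∈ Icc 0 ε) :
      HasDerivAt (fun t ↦ (α t).2) (-Γ (α t).1 (α t).2 (α t).2) t := (hα t ht).2.snd
  have hVm (t) : k (α t).1 ∈ V ↔ k (α t).1 ∈ φ.source ∧ φ (k (α t).1) ∈ closedBall q s :=
    φ.mem_symm_image_iff hs
  have main : ∀ T ∈ Icc 0 ε, (∀ τ ∈ Icc 0 T, k (α τ).1 ∈ V) →
      ‖φ (k (α T).1) - φ (k (α 0).1)‖ ≤ 2 * δ * T := fun T hT hτ ↦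
    h.norm_image_geodesic_sub_le hΓ hΓ' (x := fun t ↦ (α t).1) (w := fun t ↦ (α t).2) hC hε hδ hCδ
      h0δ hT (fun t ht ↦ ⟨(hα t ⟨ht.1, ht.2.trans hT.2⟩).1, hx t ⟨ht.1, ht.2.trans hT.2⟩,
        hw t ⟨ht.1, ht.2.trans hT.2⟩⟩) fun τ h' ↦ (hVm τ).1 (hτ τ h')
  -- As long as the image stays in the ball it moves by at most `2 * δ * ε < s / 2` from a start
  -- within `s / 2` of `q`, so it never reaches the boundary.
  have hstay : ∀ t ∈ Icc 0 ε, k (α t).1 ∈ V := by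
    refine φ.forall_mem_of_continuousOn_Icc hs (fun t ht ↦ ?_) ?_ ?_
    · exact ((h.continuousAt (hα t ht).1).comp
        (f := fun t ↦ (α t).1) (hx t ht).continuousAt).continuousWithinAt
    · exact (hVm 0).2 ⟨h0, closedBall_subset_closedBall (by linarith) h0'⟩
    · intro t ht hτ
      have h1 := main t ⟨ht.1, ht.2.le⟩ hτ
      rw [mem_closedBall_iff_norm] at h0'
      rw [mem_ball_iff_norm]
      calc ‖φ (k (α t).1) - q‖ ≤ ‖φ (k (α t).1) - φ (k (α 0).1)‖ + ‖φ (k (α 0).1) - q‖ :=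
            norm_sub_le_norm_sub_add_norm_sub _ _ _
        _ ≤ 2 * δ * ε + s / 2 := by
          gcongr
          refine h1.trans ?_
          gcongr
          exact ht.2.le
        _ < s := by linarith
  have hεm : ε ∈ Icc 0 ε := ⟨hε.le, le_rfl⟩
  exact ⟨((hVm ε).1 (hstay ε hεm)).1, main ε hεm hstay⟩

end IsPuncturedIsometry

end PuncturedIsometry

/-! ### The derivative is bounded below near the puncture -/

section PuncturedIsometry

set_option maxSynthPendingDepth 3

open Set Filter Topology Metric

namespace IsPuncturedIsometry

variable {E : Type*} [NormedAddCommGroup E] [InnerProductSpace ℝ E] [FiniteDimensional ℝ E]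
  {N : Type*} [TopologicalSpace N] [T2Space N] {O : Set E} {p : E} {G : E → E →L[ℝ] E →L[ℝ] ℝ}
  {φ : OpenPartialHomeomorph N E} {H : E → E →L[ℝ] E →L[ℝ] ℝ} {k : E → N}

/-- Geodesics starting near `p` which point away from `p` leave a fixed neighbourhood of `p` in a
uniform time. -/
theorem exists_geodesic {Γ : E → E →L[ℝ] E →L[ℝ] E} (hO : O ∈ 𝓝 p) (hΓ : ContDiffOn ℝ ∞ Γ O)
    {v₀ : E} : ∃ ε > (0 : ℝ), ∃ r > (0 : ℝ), closedBall p r ⊆ O ∧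
      ∀ᶠ z in 𝓝 (p, v₀), ‖z.2‖ = 1 → z.1 ≠ p → 0 ≤ inner ℝ (z.1 - p) z.2 →
        ∃ α : ℝ → E × E, α 0 = z ∧ (α ε).1 ∈ closedBall p r \ ball p (ε / 2) ∧
          ∀ t ∈ Icc 0 ε, (α t).1 ∈ O \ {p} ∧
            HasDerivAt α ((α t).2, -Γ (α t).1 (α t).2 (α t).2) t := by
  obtain ⟨r, hr, hrO⟩ := Metric.nhds_basis_closedBall.mem_iff.1 hO
  have hX : ContDiffAt ℝ 1 (fun z : E × E ↦ (z.2, -Γ z.1 z.2 z.2)) (p, v₀) := by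
    have h1 : ContDiffAt ℝ 1 (fun z : E × E ↦ Γ z.1) (p, v₀) :=
      ((hΓ.contDiffAt hO).of_le ENat.LEInfty.out).comp (p, v₀) contDiffAt_fst
    exact contDiffAt_snd.prodMk ((h1.clm_apply contDiffAt_snd).clm_apply contDiffAt_snd).neg
  obtain ⟨ε, hε, hev⟩ := hX.exists_forall_mem_Icc_hasDerivAt
    (prod_mem_nhds (closedBall_mem_nhds p hr) (closedBall_mem_nhds v₀ (by norm_num : (0:ℝ) < 1 / 4)))
  refine ⟨ε, hε, r, hr, hrO, ?_⟩
  filter_upwards [hev, prod_mem_nhds (univ_mem (f := 𝓝 p))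
    (closedBall_mem_nhds v₀ (by norm_num : (0:ℝ) < 1 / 4))] with z hz hzv h1 hzp hin
  obtain ⟨α, h0, hα⟩ := hz
  have hder (t) (ht : t ∈ Icc 0 ε) :
      HasDerivAt (fun t ↦ inner ℝ ((α t).1 - p) z.2 - t / 2) (inner ℝ (α t).2 z.2 - 1 / 2) t := by
    have e1 : HasDerivAt (fun t ↦ (α t).1 - p) (α t).2 t :=
      HasDerivAt.sub_const p (hα t ht).2.fst
    have e2 : HasDerivAt (fun t ↦ inner ℝ ((α t).1 - p) z.2) (inner ℝ (α t).2 z.2) t := by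
      simpa using e1.inner ℝ (hasDerivAt_const t z.2)
    exact e2.sub ((hasDerivAt_id t).div_const 2)
  -- Both `(α t).2` and `z.2` are within `1 / 4` of `v₀`, and `z.2` is a unit vector. Hence the
  -- component of `(α t).1 - p` along `z.2`, initially nonnegative, grows at rate at least `1 / 2`.
  have hvel (t) (ht : t ∈ Icc 0 ε) : 1 / 2 ≤ inner ℝ (α t).2 z.2 := by
    have e1 : ‖(α t).2 - z.2‖ ≤ 1 / 2 := by
      have e2 := (hα t ht).1.2
      have e3 := hzv.2
      rw [mem_closedBall] at e2 e3
      rw [← dist_eq_norm]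
      linarith [dist_triangle_right (α t).2 z.2 v₀]
    have e2 := real_inner_le_norm (z.2 - (α t).2) z.2
    rw [inner_sub_left, real_inner_self_eq_norm_sq, h1, norm_sub_rev] at e2
    linarith
  have hmono : MonotoneOn (fun t ↦ inner ℝ ((α t).1 - p) z.2 - t / 2) (Icc 0 ε) := by
    refine monotoneOn_of_deriv_nonneg (convex_Icc 0 ε)
      (fun t ht ↦ (hder t ht).continuousAt.continuousWithinAt)
      (fun t ht ↦ (hder t (interior_subset ht)).differentiableAt.differentiableWithinAt) ?_
    intro t ht
    rw [(hder t (interior_subset ht)).deriv]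
    linarith [hvel t (interior_subset ht)]
  have hdist (t) (ht : t ∈ Icc 0 ε) : t / 2 ≤ ‖(α t).1 - p‖ := by
    have e1 := hmono ⟨le_rfl, hε.le⟩ ht ht.1
    simp only [h0, zero_div, sub_zero] at e1
    have e2 := real_inner_le_norm ((α t).1 - p) z.2
    rw [h1, mul_one] at e2
    linarith
  refine ⟨α, h0, ⟨(hα ε ⟨hε.le, le_rfl⟩).1.1, ?_⟩, fun t ht ↦ ⟨⟨hrO (hα t ht).1.1, ?_⟩,
    (hα t ht).2⟩⟩
  · rw [mem_ball_iff_norm, not_lt]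
    exact hdist ε ⟨hε.le, le_rfl⟩
  · rintro (h : (α t).1 = p)
    rcases ht.1.eq_or_lt with h' | h'
    · rw [← h', h0] at h
      exact hzp h
    · have := hdist t ht
      rw [h, sub_self, norm_zero] at this
      linarith

/-- An isometry off `p` does not contract vectors near `p`, where its values are close to a point
outside its image. -/
theorem exists_le_norm_fderiv (h : IsPuncturedIsometry O p G φ H k) {q : E} (hq : q ∈ φ.target)
    (hqk : ∀ x ∈ O \ {p}, k x ≠ φ.symm q) :
    ∃ δ > (0 : ℝ), ∀ x ∈ O \ {p}, x ∈ ball p δ → k x ∈ φ.source → φ (k x) ∈ ball q δ →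
      ∀ v, δ * ‖v‖ ≤ ‖fderiv ℝ (φ ∘ k) x v‖ := by
  by_contra hcon
  push Not at hcon
  -- One `δ` serves as both radii and as the lower bound, so its failure for `δ = 1 / (n + 1)`
  -- yields a single sequence of points and vectors; the vectors are normalised and, if necessary,
  -- negated so as to point away from `p`.
  have hseq : ∀ n : ℕ, ∃ z : E × E, z.1 ∈ O \ {p} ∧ z.1 ∈ ball p (1 / (n + 1)) ∧
      k z.1 ∈ φ.source ∧ φ (k z.1) ∈ ball q (1 / (n + 1)) ∧ ‖z.2‖ = 1 ∧
      0 ≤ inner ℝ (z.1 - p) z.2 ∧ ‖fderiv ℝ (φ ∘ k) z.1 z.2‖ ≤ 1 / (n + 1) := by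
    intro n
    obtain ⟨x, hxO, hxp, hxs, hxq, v, hv⟩ := hcon (1 / (n + 1)) (by positivity)
    have hv0 : v ≠ 0 := by
      rintro rfl
      simp at hv
    have hvn : 0 < ‖v‖ := norm_pos_iff.2 hv0
    have h1 : ‖‖v‖⁻¹ • v‖ = 1 := by rw [norm_smul, norm_inv, norm_norm, inv_mul_cancel₀ hvn.ne']
    have h2 : ‖fderiv ℝ (φ ∘ k) x (‖v‖⁻¹ • v)‖ ≤ 1 / (n + 1) := by
      rw [map_smul, norm_smul, norm_inv, norm_norm, inv_mul_le_iff₀ hvn]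
      linarith
    rcases le_total 0 (inner ℝ (x - p) (‖v‖⁻¹ • v)) with h3 | h3
    · exact ⟨(x, ‖v‖⁻¹ • v), hxO, hxp, hxs, hxq, h1, h3, h2⟩
    · refine ⟨(x, -(‖v‖⁻¹ • v)), hxO, hxp, hxs, hxq, by rwa [norm_neg], ?_, ?_⟩
      · rw [inner_neg_right]; linarith
      · rwa [map_neg, norm_neg]
  choose z hzO hzp hzs hzq hz1 hzin hzδ using hseq
  have hlim : Tendsto (fun n : ℕ ↦ (1 : ℝ) / (n + 1)) atTop (𝓝 0) :=
    tendsto_one_div_add_atTop_nhds_zero_nat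
  obtain ⟨v₀, -, ψ, hψ, hv₀⟩ := (isCompact_sphere (0 : E) 1).tendsto_subseq
    (x := fun n ↦ (z n).2) (fun n ↦ by simp [hz1])
  have hψ' : Tendsto ψ atTop atTop := hψ.tendsto_atTop
  have hx₀ : Tendsto (fun n ↦ (z n).1) atTop (𝓝 p) :=
    tendsto_iff_dist_tendsto_zero.2 (squeeze_zero (fun _ ↦ dist_nonneg) (fun n ↦ (hzp n).le) hlim)
  have hq₀ : Tendsto (fun n ↦ φ (k (z n).1)) atTop (𝓝 q) :=
    tendsto_iff_dist_tendsto_zero.2 (squeeze_zero (fun _ ↦ dist_nonneg) (fun n ↦ (hzq n).le) hlim)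
  have hz : Tendsto (fun n ↦ z (ψ n)) atTop (𝓝 (p, v₀)) := (hx₀.comp hψ').prodMk_nhds hv₀
  obtain ⟨Γ, hΓ, hΓc⟩ := exists_isChristoffelAt h.isOpen h.contDiffOn_left h.isInvertible_left
  obtain ⟨Γ', hΓ', hΓc'⟩ := exists_isChristoffelAt φ.open_target h.contDiffOn_right
    h.isInvertible_right
  obtain ⟨ε, hε, r, hr, hrO, hgeo⟩ := exists_geodesic (v₀ := v₀) (h.isOpen.mem_nhds h.mem) hΓ
  obtain ⟨s, hs, hsφ⟩ := Metric.nhds_basis_closedBall.mem_iff.1 (φ.open_target.mem_nhds hq)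
  obtain ⟨C, hC⟩ := (isCompact_closedBall q s).exists_bound_of_continuousOn
    (hΓ'.continuousOn.mono hsφ)
  -- The endpoints `y` of the geodesics lie in a compact annulus about `p`, while their images stay
  -- close to those of the initial points, which tend to `q`.
  have hev : ∀ᶠ n in atTop, ∃ y ∈ closedBall p r \ ball p (ε / 2), k y ∈ φ.source ∧
      dist (φ (k y)) (φ (k (z (ψ n)).1)) ≤ 2 * (1 / ((ψ n : ℕ) + 1)) * ε := by
    have e1 : ∀ᶠ n in atTop, 4 * C * (1 / ((ψ n : ℕ) + 1)) * ε < 1 := by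
      have : Tendsto (fun n ↦ 4 * C * (1 / ((ψ n : ℕ) + 1 : ℝ)) * ε) atTop (𝓝 (4 * C * 0 * ε)) :=
        ((hlim.comp hψ').const_mul (4 * C)).mul_const ε
      exact this.eventually_lt_const (by simp)
    have e2 : ∀ᶠ n in atTop, 2 * (1 / ((ψ n : ℕ) + 1)) * ε < s / 2 := by
      have : Tendsto (fun n ↦ 2 * (1 / ((ψ n : ℕ) + 1 : ℝ)) * ε) atTop (𝓝 (2 * 0 * ε)) :=
        ((hlim.comp hψ').const_mul 2).mul_const ε
      exact this.eventually_lt_const (by simpa using hs)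
    have e3 : ∀ᶠ n in atTop, φ (k (z (ψ n)).1) ∈ closedBall q (s / 2) :=
      (hq₀.comp hψ').eventually (closedBall_mem_nhds q (by positivity))
    filter_upwards [e1, e2, e3, hz.eventually hgeo] with n h1 h2 h3 h4
    obtain ⟨α, hα0, hαε, hα⟩ := h4 (hz1 _) (hzO _).2 (hzin _)
    have := h.image_geodesic hΓc hΓc' hsφ hC hε (by positivity) h1 h2 hα
      (by rw [hα0]; exact hzs _) (by rw [hα0]; exact h3) (by rw [hα0]; exact hzδ _)
    rw [hα0, ← dist_eq_norm] at this
    exact ⟨_, hαε, this⟩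
  obtain ⟨n₀, hn₀⟩ := eventually_atTop.1 hev
  choose y hyA hys hyq using fun n ↦ hn₀ (n + n₀) (Nat.le_add_left _ _)
  have hψn : Tendsto (fun n ↦ ψ (n + n₀)) atTop atTop := hψ'.comp (tendsto_add_atTop_nat n₀)
  have hyq' : Tendsto (fun n ↦ φ (k (y n))) atTop (𝓝 q) := by
    refine (hq₀.comp hψn).congr_dist ?_
    refine squeeze_zero (fun _ ↦ dist_nonneg) (fun n ↦ (dist_comm _ _).trans_le (hyq n)) ?_
    simpa using ((hlim.comp hψn).const_mul 2).mul_const ε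
  have hky : Tendsto (fun n ↦ k (y n)) atTop (𝓝 (φ.symm q)) :=
    ((φ.continuousAt_symm hq).tendsto.comp hyq').congr fun n ↦ φ.left_inv (hys n)
  -- A limit `y₀ ≠ p` of the endpoints would be mapped to `φ.symm q`.
  obtain ⟨y₀, hy₀, θ, hθ, hyθ⟩ := ((isCompact_closedBall p r).diff isOpen_ball).tendsto_subseq hyA
  have hy₀O : y₀ ∈ O \ {p} :=
    ⟨hrO hy₀.1, fun h' ↦ hy₀.2 (by rw [show y₀ = p from h']; exact mem_ball_self (by positivity))⟩
  exact hqk y₀ hy₀O (tendsto_nhds_unique ((h.continuousAt hy₀O).tendsto.comp hyθ)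
    (hky.comp hθ.tendsto_atTop))

end IsPuncturedIsometry

end PuncturedIsometry

/-! ### Upper bound on the derivative and extension over the puncture -/

section PuncturedIsometry

set_option maxSynthPendingDepth 3

open Set Filter Topology Metric

namespace IsPuncturedIsometry

variable {E : Type*} [NormedAddCommGroup E] [InnerProductSpace ℝ E] [FiniteDimensional ℝ E]
  {N : Type*} [TopologicalSpace N] [T2Space N] {O : Set E} {p : E} {G : E → E →L[ℝ] E →L[ℝ] ℝ}
  {φ : OpenPartialHomeomorph N E} {H : E → E →L[ℝ] E →L[ℝ] ℝ} {k : E → N}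

/-- Duality turns the lower bound of `exists_le_norm_fderiv` into an upper one, `G` and the inverse
of `H` being bounded on compact balls. The bound only concerns points whose values are near `q`. -/
theorem exists_norm_fderiv_le (h : IsPuncturedIsometry O p G φ H k) {q : E} (hq : q ∈ φ.target)
    (hqk : ∀ x ∈ O \ {p}, k x ≠ φ.symm q) :
    ∃ K ≥ (0 : ℝ), ∃ r > (0 : ℝ), ∀ x ∈ O \ {p}, x ∈ ball p r → k x ∈ φ.source →
      φ (k x) ∈ ball q r → ‖fderiv ℝ (φ ∘ k) x‖ ≤ K := by
  obtain ⟨δ, hδ, hδk⟩ := h.exists_le_norm_fderiv hq hqk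
  obtain ⟨r, hr, hrO⟩ := Metric.nhds_basis_closedBall.mem_iff.1 (h.isOpen.mem_nhds h.mem)
  obtain ⟨s, hs, hsφ⟩ := Metric.nhds_basis_closedBall.mem_iff.1 (φ.open_target.mem_nhds hq)
  obtain ⟨C, hC⟩ := (isCompact_closedBall p r).exists_bound_of_continuousOn
    (h.contDiffOn_left.continuousOn.mono hrO)
  have hinv : ContinuousOn (fun y ↦ (H y).inverse) φ.target := fun y hy ↦
    (((h.isInvertible_right y hy).contDiffAt_map_inverse (n := 0)).continuousAt).comp_continuousWithinAt
      (h.contDiffOn_right.continuousOn y hy)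
  obtain ⟨C', hC'⟩ := (isCompact_closedBall q s).exists_bound_of_continuousOn (hinv.mono hsφ)
  have hC0 : 0 ≤ C := (norm_nonneg _).trans (hC p (mem_closedBall_self hr.le))
  refine ⟨max C C' * max C C' / δ, by positivity, min δ (min r s), by positivity,
    fun x hxO hxp hxs hxq ↦ ?_⟩
  have hxr : x ∈ closedBall p r := ball_subset_closedBall
    (ball_subset_ball ((min_le_right _ _).trans (min_le_left _ _)) hxp)
  have hxs' : φ (k x) ∈ closedBall q s := ball_subset_closedBall
    (ball_subset_ball ((min_le_right _ _).trans (min_le_right _ _)) hxq)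
  exact norm_le_of_pullback_eq hδ (h.isInvertible_left x hxO.1).injective
    ((hC x hxr).trans (le_max_left _ _)) (h.isInvertible_right _ (hsφ hxs'))
    ((hC' _ hxs').trans (le_max_right _ _)) (h.pullback_eq x hxO hxs)
    (hδk x hxO (ball_subset_ball (min_le_left _ _) hxp) hxs
      (ball_subset_ball (min_le_left _ _) hxq))

/-- If an isometry off `p` takes values near a point outside its image, at points near `p`, then it
converges to this point at `p`. -/
theorem exists_ball_mapsTo (h : IsPuncturedIsometry O p G φ H k) (hE : 1 < Module.rank ℝ E) {q : E}
    (hq : q ∈ φ.target) (hqk : ∀ x ∈ O \ {p}, k x ≠ φ.symm q)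
    (hcl : ∀ η > (0 : ℝ), ∃ x ∈ O \ {p}, x ∈ ball p η ∧ k x ∈ φ.source ∧ φ (k x) ∈ ball q η)
    {η : ℝ} (hη : 0 < η) :
    ∃ ρ > (0 : ℝ), ∀ x ∈ ball p ρ \ {p}, x ∈ O ∧ k x ∈ φ.source ∧ φ (k x) ∈ closedBall q η := by
  obtain ⟨K, hK, r, hr, hKr⟩ := h.exists_norm_fderiv_le hq hqk
  obtain ⟨s, hs, hsφ⟩ := Metric.nhds_basis_closedBall.mem_iff.1 (φ.open_target.mem_nhds hq)
  obtain ⟨r', hr', hrO⟩ := Metric.nhds_basis_ball.mem_iff.1 (h.isOpen.mem_nhds h.mem)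
  -- Shrinking `η` puts the closed ball about `q` inside the chart and inside the region where the
  -- derivative bound holds.
  wlog hηs : η ≤ s ∧ η < r generalizing η
  · obtain ⟨ρ, hρ, H⟩ := this (η := min η (min s (r / 2))) (by positivity)
      ⟨(min_le_right _ _).trans (min_le_left _ _),
        (min_le_right _ _).trans_lt ((min_le_right _ _).trans_lt (by linarith))⟩
    exact ⟨ρ, hρ, fun x hx ↦ ⟨(H x hx).1, (H x hx).2.1,
      closedBall_subset_closedBall (min_le_left _ _) (H x hx).2.2⟩⟩
  -- A segment in the ball of radius `ρ` has length at most `2 * ρ`, so its image moves by at most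
  -- `K * (2 * ρ) < η / 2`; starting within `η / 2` of `q`, it cannot leave the region where the
  -- bound `K` is valid.
  set ρ := min (min r r') (η / (8 * (K + 1))) with hρ
  have hρ0 : 0 < ρ := by positivity
  have hρr : ρ ≤ r := (min_le_left _ _).trans (min_le_left _ _)
  have hρr' : ρ ≤ r' := (min_le_left _ _).trans (min_le_right _ _)
  have hρη : K * (2 * ρ) < η / 2 := by
    have e1 : ρ ≤ η / (8 * (K + 1)) := min_le_right _ _
    rw [le_div_iff₀ (by positivity)] at e1
    nlinarith
  have hBO : ball p ρ \ {p} ⊆ O \ {p} := fun x hx ↦ ⟨hrO (ball_subset_ball hρr' hx.1), hx.2⟩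
  have hηφ : closedBall q η ⊆ φ.target := (closedBall_subset_closedBall hηs.1).trans hsφ
  set V := φ.symm '' closedBall q η with hV
  have hVcl : IsClosed V := φ.isClosed_symm_image (isCompact_closedBall q η) hηφ
  have hVm (y : N) : y ∈ V ↔ y ∈ φ.source ∧ φ y ∈ closedBall q η := φ.mem_symm_image_iff hηφ
  obtain ⟨x₁, hx₁O, hx₁p, hx₁s, hx₁q⟩ := hcl (min ρ (η / 2)) (by positivity)
  have hx₁ : x₁ ∈ ball p ρ \ {p} := ⟨ball_subset_ball (min_le_left _ _) hx₁p, hx₁O.2⟩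
  have hx₁η : ‖φ (k x₁) - q‖ < η / 2 := by
    rw [← mem_ball_iff_norm]
    exact ball_subset_ball (min_le_right _ _) hx₁q
  have hseg : ∀ z ∈ ball p ρ \ {p}, p ∉ segment ℝ x₁ z → k z ∈ V := by
    intro z hz hpz
    set x : ℝ → E := fun t ↦ x₁ + t • (z - x₁) with hx
    have hxB : ∀ t ∈ Icc (0 : ℝ) 1, x t ∈ ball p ρ \ {p} := by
      intro t ht
      have : x t ∈ segment ℝ x₁ z := by
        rw [segment_eq_image']; exact ⟨t, ht, rfl⟩
      exact ⟨(convex_ball p ρ).segment_subset hx₁.1 hz.1 this, fun h' ↦ hpz (h' ▸ this)⟩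
    have hxd (t : ℝ) : HasDerivAt x (z - x₁) t := by
      have := ((hasDerivAt_id t).smul_const (z - x₁)).const_add x₁
      rwa [one_smul] at this
    have hzx : ‖z - x₁‖ ≤ 2 * ρ := by
      have e1 := hz.1
      have e2 := hx₁.1
      rw [mem_ball] at e1 e2
      rw [← dist_eq_norm]
      linarith [dist_triangle_right z x₁ p]
    have hx0 : x 0 = x₁ := by simp [hx]
    have hx1 : x 1 = z := by simp [hx]
    rw [← hx1]
    refine φ.forall_mem_of_continuousOn_Icc (κ := fun t ↦ k (x t)) hηφ (fun t ht ↦ ?_) ?_ ?_ 1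
      ⟨zero_le_one, le_rfl⟩
    · exact ((h.continuousAt (hBO (hxB t ht))).comp (hxd t).continuousAt).continuousWithinAt
    · rw [hx0]
      exact (hVm _).2 ⟨hx₁s, mem_closedBall_iff_norm.2 (by linarith)⟩
    · intro t ht hτ
      have hder (τ) (h' : τ ∈ Icc 0 t) : HasDerivAt (fun τ ↦ φ (k (x τ)))
          (fderiv ℝ (φ ∘ k) (x τ) (z - x₁)) τ :=
        (h.hasFDerivAt (hBO (hxB τ ⟨h'.1, h'.2.trans ht.2.le⟩))
          ((hVm _).1 (hτ τ h')).1).comp_hasDerivAt τ (hxd τ)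
      have e1 := norm_image_sub_le_of_norm_deriv_le_segment' (C := K * (2 * ρ))
        (fun τ h' ↦ (hder τ h').hasDerivWithinAt) (fun τ h' ↦ ?_) t ⟨ht.1, le_rfl⟩
      · simp only [hx0, sub_zero] at e1
        rw [mem_ball_iff_norm]
        calc ‖φ (k (x t)) - q‖ ≤ ‖φ (k (x t)) - φ (k x₁)‖ + ‖φ (k x₁) - q‖ :=
              norm_sub_le_norm_sub_add_norm_sub _ _ _
          _ ≤ K * (2 * ρ) * 1 + ‖φ (k x₁) - q‖ := by
              gcongr
              refine e1.trans ?_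
              gcongr
              exact ht.2.le
          _ < η := by linarith
      · have hm : τ ∈ Icc 0 t := ⟨h'.1, h'.2.le⟩
        have hxτ := hxB τ ⟨h'.1, h'.2.le.trans ht.2.le⟩
        have hVτ := (hVm _).1 (hτ τ hm)
        refine (ContinuousLinearMap.le_opNorm _ _).trans ?_
        gcongr
        exact hKr _ (hBO hxτ) (ball_subset_ball hρr hxτ.1) hVτ.1
          (closedBall_subset_ball hηs.2 hVτ.2)
  refine ⟨ρ, hρ0, fun z hz ↦ ⟨(hBO hz).1, (hVm _).1 ?_⟩⟩
  -- Points hidden behind `p` from `x₁` are limits of visible ones, and `V` is closed.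
  have hfr : ∃ᶠ y in 𝓝 z, y ∈ {y : E | p ∉ segment ℝ x₁ y} :=
    mem_closure_iff_frequently.1 (dense_notMem_segment hE hx₁O.2 z)
  have hopen : ball p ρ \ {p} ∈ 𝓝 z := (isOpen_ball.sdiff isClosed_singleton).mem_nhds hz
  by_contra hzV
  have hev : ∀ᶠ y in 𝓝 z, k y ∉ V :=
    (h.continuousAt (hBO hz)).eventually (hVcl.isOpen_compl.mem_nhds hzV)
  obtain ⟨y, hy, hyV, hyB⟩ := (hfr.and_eventually (hev.and hopen)).exists
  exact hyV (hseg y hyB hy)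

theorem tendsto_punctured (h : IsPuncturedIsometry O p G φ H k) (hE : 1 < Module.rank ℝ E) {q : E}
    (hq : q ∈ φ.target) (hqk : ∀ x ∈ O \ {p}, k x ≠ φ.symm q)
    (hcl : ∀ η > (0 : ℝ), ∃ x ∈ O \ {p}, x ∈ ball p η ∧ k x ∈ φ.source ∧ φ (k x) ∈ ball q η) :
    Tendsto k (𝓝[≠] p) (𝓝 (φ.symm q)) := by
  have hev : ∀ η > (0 : ℝ), ∀ᶠ x in 𝓝[≠] p, k x ∈ φ.source ∧ φ (k x) ∈ closedBall q η := by
    intro η hη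
    obtain ⟨ρ, hρ, H⟩ := h.exists_ball_mapsTo hE hq hqk hcl hη
    rw [eventually_nhdsWithin_iff]
    filter_upwards [ball_mem_nhds p hρ] with x hx hxp using (H x ⟨hx, hxp⟩).2
  have h1 : Tendsto (fun x ↦ φ (k x)) (𝓝[≠] p) (𝓝 q) :=
    Metric.nhds_basis_closedBall.tendsto_right_iff.2 fun η hη ↦ (hev η hη).mono fun x hx ↦ hx.2
  refine ((φ.continuousAt_symm hq).tendsto.comp h1).congr' ?_
  filter_upwards [hev 1 one_pos] with x hx using φ.left_inv hx.1

/-- An isometry off `p` extends to a smooth isometry near `p`, if it takes values near a point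
outside its image, at points near `p`. -/
theorem contDiffAt_update [DecidableEq E] (h : IsPuncturedIsometry O p G φ H k)
    (hE : 1 < Module.rank ℝ E)
    {q : E} (hq : q ∈ φ.target) (hqk : ∀ x ∈ O \ {p}, k x ≠ φ.symm q)
    (hcl : ∀ η > (0 : ℝ), ∃ x ∈ O \ {p}, x ∈ ball p η ∧ k x ∈ φ.source ∧ φ (k x) ∈ ball q η) :
    ContDiffAt ℝ ∞ (Function.update (φ ∘ k) p q) p ∧
      ∀ v w, H q (fderiv ℝ (Function.update (φ ∘ k) p q) p v)
        (fderiv ℝ (Function.update (φ ∘ k) p q) p w) = G p v w := by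
  have hne := neBot_nhdsNE_of_one_lt_rank hE p
  obtain ⟨Γ, hΓ, hΓc⟩ := exists_isChristoffelAt h.isOpen h.contDiffOn_left h.isInvertible_left
  obtain ⟨Γ', hΓ', hΓc'⟩ := exists_isChristoffelAt φ.open_target h.contDiffOn_right
    h.isInvertible_right
  obtain ⟨K, hK, r₀, hr₀, hKr⟩ := h.exists_norm_fderiv_le hq hqk
  obtain ⟨s, hs, hsφ⟩ := Metric.nhds_basis_closedBall.mem_iff.1 (φ.open_target.mem_nhds hq)
  obtain ⟨r₁, hr₁, hrO⟩ := Metric.nhds_basis_closedBall.mem_iff.1 (h.isOpen.mem_nhds h.mem)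
  obtain ⟨r₂, hr₂, hmaps⟩ := h.exists_ball_mapsTo hE hq hqk hcl
    (η := min s (r₀ / 2)) (by positivity)
  set r := min r₀ (min r₁ r₂) with hr
  have hr0 : 0 < r := by positivity
  have hrr₁ : r ≤ r₁ := (min_le_right _ _).trans (min_le_left _ _)
  have hrr₂ : r ≤ r₂ := (min_le_right _ _).trans (min_le_right _ _)
  have hB : ∀ x ∈ ball p r \ {p}, x ∈ O \ {p} ∧ k x ∈ φ.source ∧
      φ (k x) ∈ closedBall q (min s (r₀ / 2)) := fun x hx ↦ by
    have := hmaps x ⟨ball_subset_ball hrr₂ hx.1, hx.2⟩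
    exact ⟨⟨this.1, hx.2⟩, this.2⟩
  set W : Set (E × (E × (E →L[ℝ] E))) := O ×ˢ (φ.target ×ˢ univ) with hW
  -- The system for `(f, Df)`: the first component says that the derivative of `f` is `Df`, the
  -- second is `fderiv_fderiv`.
  let Θ : E × (E × (E →L[ℝ] E)) → E →L[ℝ] (E × (E →L[ℝ] E)) := fun z ↦
    z.2.2.prod ((ContinuousLinearMap.compL ℝ E E E z.2.2).comp (Γ z.1) -
      (Γ' z.2.1).bilinearComp z.2.2 z.2.2)
  have hΘ : ContDiffOn ℝ ∞ Θ W := by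
    have hA : ContDiffOn ℝ ∞ (fun z : E × (E × (E →L[ℝ] E)) ↦ z.2.2) W :=
      (contDiff_snd.comp contDiff_snd).contDiffOn
    have h1 : ContDiffOn ℝ ∞ (fun z : E × (E × (E →L[ℝ] E)) ↦ Γ z.1) W :=
      hΓ.comp contDiff_fst.contDiffOn fun z hz ↦ hz.1
    have h2 : ContDiffOn ℝ ∞ (fun z : E × (E × (E →L[ℝ] E)) ↦ Γ' z.2.1) W :=
      hΓ'.comp (contDiff_fst.comp contDiff_snd).contDiffOn fun z hz ↦ hz.2.1
    refine contDiffOn_clm_apply.2 fun u ↦ ?_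
    refine ContDiffOn.prodMk (f := fun z : E × (E × (E →L[ℝ] E)) ↦ z.2.2 u)
      (hA.clm_apply contDiffOn_const) ?_
    refine contDiffOn_clm_apply.2 fun v ↦ ?_
    exact (hA.clm_apply ((h1.clm_apply contDiffOn_const).clm_apply contDiffOn_const)).sub
      ((h2.clm_apply (hA.clm_apply contDiffOn_const)).clm_apply (hA.clm_apply contDiffOn_const))
  have hcomp : IsCompact (closedBall q (min s (r₀ / 2)) ×ˢ closedBall (0 : E →L[ℝ] E) K) :=
    (isCompact_closedBall _ _).prod (isCompact_closedBall _ _)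
  obtain ⟨z, -, hz, hsm, hder⟩ := exists_contDiffOn_update_of_hasFDerivAt_eq hE hr0
    (W := W) (h.isOpen.prod (φ.open_target.prod isOpen_univ)) hΘ hcomp
    (Z := fun x ↦ (φ (k x), fderiv ℝ (φ ∘ k) x))
    (fun y hy ↦ ⟨hrO (closedBall_subset_closedBall hrr₁ hy.1),
      hsφ (closedBall_subset_closedBall (min_le_left _ _) hy.2.1), mem_univ _⟩)
    (fun x hx ↦ by
      obtain ⟨h1, h2, h3⟩ := hB x hx
      refine ⟨h3, mem_closedBall_zero_iff.2 (hKr x h1 (ball_subset_ball (min_le_left _ _) hx.1) h2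
        (closedBall_subset_ball ?_ h3))⟩
      exact (min_le_right _ _).trans_lt (by linarith))
    (fun x hx ↦ by
      obtain ⟨h1, h2, h3⟩ := hB x hx
      have e1 := (h.hasFDerivAt h1 h2).prodMk (h.hasFDerivAt_fderiv h1 h2)
      refine e1.congr_fderiv ?_
      ext u v
      · rfl
      · exact h.fderiv_fderiv hΓc hΓc' h1 h2 u v)
  have hlim : Tendsto (fun x ↦ φ (k x)) (𝓝[≠] p) (𝓝 q) := by
    have := ((φ.continuousAt (φ.map_target hq)).tendsto).comp (h.tendsto_punctured hE hq hqk hcl)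
    rwa [φ.right_inv hq] at this
  -- The system produces some limit `z` of `(f, Df)`; its first component is the prescribed value,
  -- and its second is the derivative of the extension at `p`.
  have hz1 : z.1 = q := tendsto_nhds_unique ((continuous_fst.tendsto z).comp hz) hlim
  have hupd : Function.update (φ ∘ k) p q =
      fun x ↦ (Function.update (fun x ↦ (φ (k x), fderiv ℝ (φ ∘ k) x)) p z x).1 := by
    funext x
    rcases eq_or_ne x p with rfl | hx
    · simp [hz1]
    · simp [hx]
  have hd : fderiv ℝ (Function.update (φ ∘ k) p q) p = z.2 := by
    rw [hupd]
    have := (hder p (mem_ball_self hr0)).fst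
    rw [Function.update_self] at this
    exact this.fderiv
  refine ⟨?_, fun v w ↦ ?_⟩
  · rw [hupd]
    exact (contDiff_fst.comp_contDiffOn hsm).contDiffAt (ball_mem_nhds p hr0)
  · rw [hd]
    have hA : Tendsto (fun x ↦ fderiv ℝ (φ ∘ k) x) (𝓝[≠] p) (𝓝 z.2) :=
      (continuous_snd.tendsto z).comp hz
    have hH : Tendsto (fun x ↦ H (φ (k x))) (𝓝[≠] p) (𝓝 (H q)) :=
      (h.contDiffOn_right.continuousOn.continuousAt (φ.open_target.mem_nhds hq)).tendsto.comp hlim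
    have hG : Tendsto (fun x ↦ G x v w) (𝓝[≠] p) (𝓝 (G p v w)) := by
      have := (h.contDiffOn_left.continuousOn.continuousAt (h.isOpen.mem_nhds h.mem))
      exact ((this.clm_apply continuousAt_const).clm_apply continuousAt_const).tendsto.mono_left
        nhdsWithin_le_nhds
    have hAv (v : E) := ((ContinuousLinearMap.apply ℝ E v).continuous.tendsto z.2).comp hA
    have hHA : Tendsto (fun x ↦ H (φ (k x)) (fderiv ℝ (φ ∘ k) x v) (fderiv ℝ (φ ∘ k) x w))
        (𝓝[≠] p) (𝓝 (H q (z.2 v) (z.2 w))) := by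
      have hc : Continuous fun a : (E →L[ℝ] E →L[ℝ] ℝ) × E × E ↦ a.1 a.2.1 a.2.2 := by fun_prop
      exact (hc.tendsto (H q, z.2 v, z.2 w)).comp (hH.prodMk_nhds ((hAv v).prodMk_nhds (hAv w)))
    -- The isometry relation at `p` is the limit of the relations off `p`.
    refine tendsto_nhds_unique hHA (hG.congr' ?_)
    rw [EventuallyEq, eventually_nhdsWithin_iff]
    filter_upwards [ball_mem_nhds p hr0] with x hx hxp
    obtain ⟨h1, h2, h3⟩ := hB x ⟨hx, hxp⟩
    exact (h.pullback_eq x h1 h2 v w).symm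

end IsPuncturedIsometry

end PuncturedIsometry

/-! ### Bilinear forms on a manifold read in the model space -/

section PullbackForm

set_option maxSynthPendingDepth 3

open Set Filter Topology

variable {d : ℕ} {M N : Type*} [TopologicalSpace M]
  [ChartedSpace (EuclideanSpace ℝ (Fin (d + 1))) M]
  [TopologicalSpace N] [ChartedSpace (EuclideanSpace ℝ (Fin (d + 1))) N]

/-- The pullback to the model space of a field of bilinear forms on a manifold. -/
noncomputable def pullbackForm
    (B : ∀ x : M, TangentSpace (𝓡 (d + 1)) x →L[ℝ] TangentSpace (𝓡 (d + 1)) x →L[ℝ] ℝ)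
    (f : EuclideanSpace ℝ (Fin (d + 1)) → M) (y : EuclideanSpace ℝ (Fin (d + 1))) :
    EuclideanSpace ℝ (Fin (d + 1)) →L[ℝ] EuclideanSpace ℝ (Fin (d + 1)) →L[ℝ] ℝ :=
  let A : EuclideanSpace ℝ (Fin (d + 1)) →L[ℝ] EuclideanSpace ℝ (Fin (d + 1)) :=
    mfderiv (𝓡 (d + 1)) (𝓡 (d + 1)) f y
  let b : EuclideanSpace ℝ (Fin (d + 1)) →L[ℝ] EuclideanSpace ℝ (Fin (d + 1)) →L[ℝ] ℝ := B (f y)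
  b.bilinearComp A A

theorem pullbackForm_apply
    (B : ∀ x : M, TangentSpace (𝓡 (d + 1)) x →L[ℝ] TangentSpace (𝓡 (d + 1)) x →L[ℝ] ℝ)
    (f : EuclideanSpace ℝ (Fin (d + 1)) → M) (y v w : EuclideanSpace ℝ (Fin (d + 1))) :
    pullbackForm B f y v w = B (f y) (mfderiv (𝓡 (d + 1)) (𝓡 (d + 1)) f y v)
      (mfderiv (𝓡 (d + 1)) (𝓡 (d + 1)) f y w) := rfl

theorem Filter.EventuallyEq.pullbackForm_eq
    (B : ∀ x : M, TangentSpace (𝓡 (d + 1)) x →L[ℝ] TangentSpace (𝓡 (d + 1)) x →L[ℝ] ℝ)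
    {f f' : EuclideanSpace ℝ (Fin (d + 1)) → M} {y : EuclideanSpace ℝ (Fin (d + 1))}
    (h : f =ᶠ[𝓝 y] f') : pullbackForm B f y = pullbackForm B f' y := by
  ext v w
  rw [pullbackForm_apply, pullbackForm_apply]
  have h1 : f y = f' y := h.self_of_nhds
  have h2 := h.mfderiv_eq (I := 𝓡 (d + 1)) (I' := 𝓡 (d + 1))
  -- The tangent spaces at equal points are distinct types syntactically but all unfold to the model
  -- space, so the form is transported by substitution of the base point.
  have key : ∀ (x x' : M) (_ : x = x') (a b : EuclideanSpace ℝ (Fin (d + 1))),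
      B x a b = B x' a b := by
    rintro x _ rfl a b; rfl
  refine (key _ _ h1 _ _).trans ?_
  exact congrArg₂ (fun a b ↦ B (f' y) a b) (DFunLike.congr_fun h2 v) (DFunLike.congr_fun h2 w)

theorem pullbackForm_comp_fderiv
    (B : ∀ x : M, TangentSpace (𝓡 (d + 1)) x →L[ℝ] TangentSpace (𝓡 (d + 1)) x →L[ℝ] ℝ)
    {f : EuclideanSpace ℝ (Fin (d + 1)) → M}
    {b : EuclideanSpace ℝ (Fin (d + 1)) → EuclideanSpace ℝ (Fin (d + 1))}
    {y : EuclideanSpace ℝ (Fin (d + 1))}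
    (hf : MDifferentiableAt (𝓡 (d + 1)) (𝓡 (d + 1)) f (b y)) (hb : DifferentiableAt ℝ b y)
    (v w : EuclideanSpace ℝ (Fin (d + 1))) :
    pullbackForm B (f ∘ b) y v w = pullbackForm B f (b y) (fderiv ℝ b y v) (fderiv ℝ b y w) := by
  have h : mfderiv (𝓡 (d + 1)) (𝓡 (d + 1)) (f ∘ b) y =
      (mfderiv (𝓡 (d + 1)) (𝓡 (d + 1)) f (b y)).comp (mfderiv (𝓡 (d + 1)) (𝓡 (d + 1)) b y) :=
    mfderiv_comp y hf hb.mdifferentiableAt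
  rw [pullbackForm_apply, pullbackForm_apply, h, mfderiv_eq_fderiv]
  rfl

theorem pullbackForm_comp_mfderiv
    {B : ∀ x : M, TangentSpace (𝓡 (d + 1)) x →L[ℝ] TangentSpace (𝓡 (d + 1)) x →L[ℝ] ℝ}
    {B' : ∀ x : N, TangentSpace (𝓡 (d + 1)) x →L[ℝ] TangentSpace (𝓡 (d + 1)) x →L[ℝ] ℝ}
    {f : EuclideanSpace ℝ (Fin (d + 1)) → M} {j : M → N} {y : EuclideanSpace ℝ (Fin (d + 1))}
    (hj : MDifferentiableAt (𝓡 (d + 1)) (𝓡 (d + 1)) j (f y))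
    (hf : MDifferentiableAt (𝓡 (d + 1)) (𝓡 (d + 1)) f y)
    (h : ∀ v w, B' (j (f y)) (mfderiv (𝓡 (d + 1)) (𝓡 (d + 1)) j (f y) v)
      (mfderiv (𝓡 (d + 1)) (𝓡 (d + 1)) j (f y) w) = B (f y) v w) :
    pullbackForm B' (j ∘ f) y = pullbackForm B f y := by
  ext v w
  rw [pullbackForm_apply, pullbackForm_apply, mfderiv_comp y hj hf]
  exact h _ _

variable [IsManifold (𝓡 (d + 1)) ∞ M] [IsManifold (𝓡 (d + 1)) ∞ N]

/-- In finite dimension it is enough to test on constant vectors `v`, `w`; their images are smooth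
sections along `f`, by smoothness of the tangent map, and `B` is evaluated on them. -/
theorem contDiffOn_pullbackForm
    {B : ∀ x : M, TangentSpace (𝓡 (d + 1)) x →L[ℝ] TangentSpace (𝓡 (d + 1)) x →L[ℝ] ℝ}
    (hB : ContMDiff (𝓡 (d + 1))
      ((𝓡 (d + 1)).prod 𝓘(ℝ, EuclideanSpace ℝ (Fin (d + 1)) →L[ℝ]
        EuclideanSpace ℝ (Fin (d + 1)) →L[ℝ] ℝ)) ∞
      (fun x ↦ Bundle.TotalSpace.mk' (EuclideanSpace ℝ (Fin (d + 1)) →L[ℝ]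
        EuclideanSpace ℝ (Fin (d + 1)) →L[ℝ] ℝ) x (B x)))
    {f : EuclideanSpace ℝ (Fin (d + 1)) → M} {O : Set (EuclideanSpace ℝ (Fin (d + 1)))}
    (hO : IsOpen O) (hf : ContMDiffOn (𝓡 (d + 1)) (𝓡 (d + 1)) ∞ f O) :
    ContDiffOn ℝ ∞ (pullbackForm B f) O := by
  refine contDiffOn_clm_apply.2 fun v ↦ contDiffOn_clm_apply.2 fun w ↦ ?_
  have htan := hf.contMDiffOn_tangentMapWithin (m := ∞) (by exact_mod_cast le_rfl)
    hO.uniqueMDiffOn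
  have hsec (v : EuclideanSpace ℝ (Fin (d + 1))) : ContMDiffOn (𝓡 (d + 1)) (𝓡 (d + 1)).tangent ∞
      (fun y ↦ (Bundle.TotalSpace.mk' (EuclideanSpace ℝ (Fin (d + 1))) (f y)
        (mfderiv (𝓡 (d + 1)) (𝓡 (d + 1)) f y v) : TangentBundle (𝓡 (d + 1)) M)) O := by
    have hv : ContMDiffOn (𝓡 (d + 1)) (𝓡 (d + 1)).tangent ∞
        (fun y : EuclideanSpace ℝ (Fin (d + 1)) ↦ (⟨y, v⟩ : TangentBundle (𝓡 (d + 1))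
          (EuclideanSpace ℝ (Fin (d + 1))))) O :=
      contMDiffOn_vectorSpace_iff_contDiffOn.2 contDiffOn_const
    refine (htan.comp hv fun y hy ↦ hy).congr fun y hy ↦ ?_
    simp only [Function.comp_apply, tangentMapWithin]
    rw [mfderivWithin_of_isOpen hO hy]
  intro y hy
  have : ContMDiffWithinAt (𝓡 (d + 1)) ((𝓡 (d + 1)).prod 𝓘(ℝ)) ∞
      (fun y ↦ Bundle.TotalSpace.mk' ℝ (E := Bundle.Trivial M ℝ) (f y)
        (B (f y) (mfderiv (𝓡 (d + 1)) (𝓡 (d + 1)) f y v)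
          (mfderiv (𝓡 (d + 1)) (𝓡 (d + 1)) f y w))) O y := by
    apply ContMDiffWithinAt.clm_bundle_apply₂ (F₁ := EuclideanSpace ℝ (Fin (d + 1)))
      (F₂ := EuclideanSpace ℝ (Fin (d + 1)))
    · exact ContMDiffAt.comp_contMDiffWithinAt y hB.contMDiffAt (hf y hy)
    · exact hsec v y hy
    · exact hsec w y hy
  simp only [Bundle.contMDiffWithinAt_totalSpace] at this
  exact this.2.contDiffWithinAt

/-- A field of bilinear forms is smooth if it is so in a chart. -/
theorem contMDiffAt_of_contDiffAt_pullbackForm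
    {B : ∀ x : M, TangentSpace (𝓡 (d + 1)) x →L[ℝ] TangentSpace (𝓡 (d + 1)) x →L[ℝ] ℝ} {x₀ : M}
    (hB : ContDiffAt ℝ ∞ (pullbackForm B (chartAt (EuclideanSpace ℝ (Fin (d + 1))) x₀).symm)
      (chartAt (EuclideanSpace ℝ (Fin (d + 1))) x₀ x₀)) :
    ContMDiffAt (𝓡 (d + 1))
      ((𝓡 (d + 1)).prod 𝓘(ℝ, EuclideanSpace ℝ (Fin (d + 1)) →L[ℝ]
        EuclideanSpace ℝ (Fin (d + 1)) →L[ℝ] ℝ)) ∞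
      (fun x ↦ Bundle.TotalSpace.mk' (EuclideanSpace ℝ (Fin (d + 1)) →L[ℝ]
        EuclideanSpace ℝ (Fin (d + 1)) →L[ℝ] ℝ) x (B x)) x₀ := by
  rw [contMDiffAt_hom_bundle]
  refine ⟨contMDiffAt_id, ?_⟩
  have hch : ContMDiffAt (𝓡 (d + 1)) (𝓡 (d + 1)) ∞
      (chartAt (EuclideanSpace ℝ (Fin (d + 1))) x₀) x₀ :=
    contMDiffAt_of_mem_maximalAtlas (IsManifold.chart_mem_maximalAtlas x₀) (mem_chart_source _ x₀)
  refine (hB.contMDiffAt.comp x₀ hch).congr_of_eventuallyEq ?_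
  filter_upwards [(chartAt (EuclideanSpace ℝ (Fin (d + 1))) x₀).open_source.mem_nhds
    (mem_chart_source _ x₀)] with x hx
  ext v w
  rw [inCoordinates_apply_eq₂ (by simpa using hx) (by simpa using hx) (by simp)]
  erw [Bundle.Trivial.linearMapAt_trivialization]
  -- The tangent bundle trivialization is the derivative of the chart, so the local representative
  -- of `B` is its pullback by the inverse chart.
  have hs (v : EuclideanSpace ℝ (Fin (d + 1))) :
      (trivializationAt (EuclideanSpace ℝ (Fin (d + 1))) (TangentSpace (𝓡 (d + 1))) x₀).symm x v =
      mfderiv (𝓡 (d + 1)) (𝓡 (d + 1)) (chartAt (EuclideanSpace ℝ (Fin (d + 1))) x₀).symm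
        (chartAt (EuclideanSpace ℝ (Fin (d + 1))) x₀ x) v := by
    have h1 := DFunLike.congr_fun
      (TangentBundle.symmL_trivializationAt (𝕜 := ℝ) (I := 𝓡 (d + 1)) hx) v
    rw [Bundle.Trivialization.symmL_apply _ (by simpa using hx)] at h1
    refine h1.trans ?_
    rw [ModelWithCorners.range_eq_univ, mfderivWithin_univ]
    rfl
  have hx' := (chartAt (EuclideanSpace ℝ (Fin (d + 1))) x₀).left_inv hx
  have key : ∀ (x x' : M) (_ : x = x') (a b : EuclideanSpace ℝ (Fin (d + 1))),
      B x a b = B x' a b := by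
    rintro x _ rfl a b; rfl
  refine (congrArg₂ (fun a b ↦ B x a b) (hs v) (hs w)).trans ?_
  exact key _ _ hx'.symm _ _

end PullbackForm

/-! ### The inverse function theorem on manifolds -/

section LocalDiffeomorph

set_option maxSynthPendingDepth 3

open Set Filter Topology

variable {n : ℕ} {M N : Type*} [TopologicalSpace M] [ChartedSpace (EuclideanSpace ℝ (Fin n)) M]
  [TopologicalSpace N] [ChartedSpace (EuclideanSpace ℝ (Fin n)) N]

/-- The inverse function theorem, for open partial homeomorphisms. -/
theorem exists_openPartialHomeomorph_of_injective_fderiv {E : Type*} [NormedAddCommGroup E]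
    [NormedSpace ℝ E] [FiniteDimensional ℝ E] {f : E → E} {T : Set E} (hT : IsOpen T)
    (hf : ContDiffOn ℝ ∞ f T) (hinj : ∀ y ∈ T, Function.Injective (fderiv ℝ f y)) {a : E}
    (ha : a ∈ T) : ∃ e : OpenPartialHomeomorph E E, a ∈ e.source ∧ e.source ⊆ T ∧ e = f ∧
      ContDiffOn ℝ ∞ e.symm e.target := by
  have hat : ∀ y ∈ T, ContDiffAt ℝ ∞ f y := fun y hy ↦ hf.contDiffAt (hT.mem_nhds hy)
  have heq : ∀ y ∈ T, ∃ A : E ≃L[ℝ] E, HasFDerivAt f (A : E →L[ℝ] E) y := by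
    intro y hy
    refine ⟨(LinearEquiv.ofInjectiveEndo (fderiv ℝ f y : E →ₗ[ℝ] E)
      (hinj y hy)).toContinuousLinearEquiv, ?_⟩
    refine (((hat y hy).differentiableAt (by simp)).hasFDerivAt).congr_fderiv ?_
    ext v
    rfl
  obtain ⟨A, hA⟩ := heq a ha
  let e₀ := (hat a ha).toOpenPartialHomeomorph f hA (by simp)
  have he₀ : (e₀ : E → E) = f := (hat a ha).toOpenPartialHomeomorph_coe hA (by simp)
  -- On `T` the derivative is invertible everywhere, which makes the inverse smooth on the whole
  -- target and not only at the image of `a`.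
  let e := e₀.restrOpen T hT
  have hes : e.source = e₀.source ∩ T := e₀.restrOpen_source T hT
  have he : (e : E → E) = f := he₀
  refine ⟨e, ?_, ?_, he, fun y hy ↦ ?_⟩
  · rw [hes]
    exact ⟨(hat a ha).mem_toOpenPartialHomeomorph_source hA (by simp), ha⟩
  · rw [hes]; exact inter_subset_right
  · have hyT : e.symm y ∈ T := by
      have := e.map_target hy
      rw [hes] at this
      exact this.2
    obtain ⟨A', hA'⟩ := heq _ hyT
    exact (e.contDiffAt_symm hy (f₀' := A') (by rw [he]; exact hA')
      (by rw [he]; exact hat _ hyT)).contDiffWithinAt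

variable [IsManifold (𝓡 n) ∞ M] [IsManifold (𝓡 n) ∞ N]

/-- The chart at a point, as a partial diffeomorphism. -/
noncomputable def chartPartialDiffeomorph (x : M) :
    PartialDiffeomorph (𝓡 n) (𝓡 n) M (EuclideanSpace ℝ (Fin n)) ∞ where
  toPartialEquiv := (chartAt (EuclideanSpace ℝ (Fin n)) x).toPartialEquiv
  open_source := (chartAt (EuclideanSpace ℝ (Fin n)) x).open_source
  open_target := (chartAt (EuclideanSpace ℝ (Fin n)) x).open_target
  contMDiffOn_toFun := contMDiffOn_of_mem_maximalAtlas (IsManifold.chart_mem_maximalAtlas x)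
  contMDiffOn_invFun := contMDiffOn_symm_of_mem_maximalAtlas (IsManifold.chart_mem_maximalAtlas x)

theorem mdifferentiableAt_chartAt {x y : M}
    (hy : y ∈ (chartAt (EuclideanSpace ℝ (Fin n)) x).source) :
    MDifferentiableAt (𝓡 n) (𝓡 n) (chartAt (EuclideanSpace ℝ (Fin n)) x) y :=
  (contMDiffAt_of_mem_maximalAtlas (n := ∞) (IsManifold.chart_mem_maximalAtlas x)
    hy).mdifferentiableAt (by simp)

theorem mdifferentiableAt_chartAt_symm {x : M} {y : EuclideanSpace ℝ (Fin n)}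
    (hy : y ∈ (chartAt (EuclideanSpace ℝ (Fin n)) x).target) :
    MDifferentiableAt (𝓡 n) (𝓡 n) (chartAt (EuclideanSpace ℝ (Fin n)) x).symm y :=
  (contMDiffAt_symm_of_mem_maximalAtlas (n := ∞) (IsManifold.chart_mem_maximalAtlas x)
    hy).mdifferentiableAt (by simp)

theorem injective_mfderiv_chartAt {x y : M}
    (hy : y ∈ (chartAt (EuclideanSpace ℝ (Fin n)) x).source) : Function.Injective
      (mfderiv (𝓡 n) (𝓡 n) (chartAt (EuclideanSpace ℝ (Fin n)) x) y) := by
  have : IsManifold (𝓡 n) 1 M := IsManifold.of_le (n := ∞) ENat.LEInfty.out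
  exact (mdifferentiable_chart (I := 𝓡 n) x).mfderiv_injective hy

theorem injective_mfderiv_chartAt_symm {x : M} {y : EuclideanSpace ℝ (Fin n)}
    (hy : y ∈ (chartAt (EuclideanSpace ℝ (Fin n)) x).target) : Function.Injective
      (mfderiv (𝓡 n) (𝓡 n) (chartAt (EuclideanSpace ℝ (Fin n)) x).symm y) := by
  have : IsManifold (𝓡 n) 1 M := IsManifold.of_le (n := ∞) ENat.LEInfty.out
  exact (mdifferentiable_chart (I := 𝓡 n) x).symm.mfderiv_injective hy

/-- The inverse function theorem on manifolds. -/
theorem isLocalDiffeomorph_of_injective_mfderiv {f : M → N}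
    (hf : ContMDiff (𝓡 n) (𝓡 n) ∞ f)
    (hinj : ∀ x, Function.Injective (mfderiv (𝓡 n) (𝓡 n) f x)) :
    IsLocalDiffeomorph (𝓡 n) (𝓡 n) ∞ f := by
  intro x
  set χ := chartAt (EuclideanSpace ℝ (Fin n)) x with hχ
  set ψ := chartAt (EuclideanSpace ℝ (Fin n)) (f x) with hψ
  set T := χ.target ∩ χ.symm ⁻¹' (f ⁻¹' ψ.source) with hTdef
  have hT : IsOpen T := χ.symm.isOpen_inter_preimage (ψ.open_source.preimage hf.continuous)
  have hχsm : ContMDiffOn (𝓡 n) (𝓡 n) ∞ χ.symm χ.target :=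
    contMDiffOn_symm_of_mem_maximalAtlas (IsManifold.chart_mem_maximalAtlas x)
  have hψm : ContMDiffOn (𝓡 n) (𝓡 n) ∞ ψ ψ.source :=
    contMDiffOn_of_mem_maximalAtlas (IsManifold.chart_mem_maximalAtlas (f x))
  have hsm : ContDiffOn ℝ ∞ (ψ ∘ f ∘ χ.symm) T :=
    (hψm.comp (hf.comp_contMDiffOn (hχsm.mono inter_subset_left))
      fun y hy ↦ hy.2).contDiffOn
  have hfd : ∀ y ∈ T, Function.Injective (fderiv ℝ (ψ ∘ f ∘ χ.symm) y) := by
    intro y hy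
    have h1 := mdifferentiableAt_chartAt_symm hy.1
    have h2 : MDifferentiableAt (𝓡 n) (𝓡 n) f (χ.symm y) := hf.mdifferentiableAt (by simp)
    have h3 := mdifferentiableAt_chartAt hy.2
    have h4 : mfderiv (𝓡 n) (𝓡 n) (ψ ∘ f ∘ χ.symm) y =
        (mfderiv (𝓡 n) (𝓡 n) ψ (f (χ.symm y))).comp
          ((mfderiv (𝓡 n) (𝓡 n) f (χ.symm y)).comp (mfderiv (𝓡 n) (𝓡 n) χ.symm y)) := by
      rw [mfderiv_comp y h3 (h2.comp y h1), mfderiv_comp y h2 h1]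
      rfl
    rw [mfderiv_eq_fderiv] at h4
    intro v w hvw
    rw [h4] at hvw
    exact injective_mfderiv_chartAt_symm hy.1 (hinj _ (injective_mfderiv_chartAt hy.2 hvw))
  have hxT : χ x ∈ T := by
    refine ⟨χ.map_source (mem_chart_source _ x), ?_⟩
    simp only [mem_preimage]
    rw [χ.left_inv (mem_chart_source _ x)]
    exact mem_chart_source _ (f x)
  obtain ⟨e, hxe, heT, he, hes⟩ := exists_openPartialHomeomorph_of_injective_fderiv hT hsm hfd hxT
  let Ψ : PartialDiffeomorph (𝓡 n) (𝓡 n) (EuclideanSpace ℝ (Fin n)) (EuclideanSpace ℝ (Fin n)) ∞ :=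
    { toPartialEquiv := e.toPartialEquiv
      open_source := e.open_source
      open_target := e.open_target
      contMDiffOn_toFun := by
        refine ContDiffOn.contMDiffOn ?_
        change ContDiffOn ℝ ∞ e e.source
        rw [he]
        exact hsm.mono heT
      contMDiffOn_invFun := hes.contMDiffOn }
  let Φ := ((chartPartialDiffeomorph x).trans Ψ).trans (chartPartialDiffeomorph (f x)).symm
  have hsrc : ∀ y, y ∈ Φ.source ↔ (y ∈ χ.source ∧ χ y ∈ e.source) ∧ e (χ y) ∈ ψ.target :=
    fun y ↦ Iff.rfl
  have hval : ∀ y, Φ y = ψ.symm (e (χ y)) := fun y ↦ rfl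
  have hback : ∀ y ∈ χ.source, χ y ∈ e.source → e (χ y) = ψ (f y) ∧ f y ∈ ψ.source := by
    intro y hy hye
    have h1 := (heT hye).2
    simp only [mem_preimage] at h1
    rw [χ.left_inv hy] at h1
    refine ⟨?_, h1⟩
    rw [he]
    simp [χ.left_inv hy]
  refine ⟨Φ, (hsrc x).2 ⟨⟨mem_chart_source _ x, hxe⟩, ?_⟩, fun y hy ↦ ?_⟩
  · obtain ⟨h1, h2⟩ := hback x (mem_chart_source _ x) hxe
    rw [h1]; exact ψ.map_source h2
  · obtain ⟨h1, h2⟩ := hback y ((hsrc y).1 hy).1.1 ((hsrc y).1 hy).1.2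
    rw [hval, h1, ψ.left_inv h2]

/-- If the chart at the source is the local diffeomorphism followed by the chart at `f x`, then `f`
reads as the identity, with trivial complement `PUnit`. -/
theorem IsLocalDiffeomorph.isImmersion {f : M → N} (hf : IsLocalDiffeomorph (𝓡 n) (𝓡 n) ∞ f) :
    Manifold.IsImmersion (𝓡 n) (𝓡 n) ∞ f := by
  suffices h : Manifold.IsImmersionOfComplement PUnit (𝓡 n) (𝓡 n) ∞ f from h.isImmersion
  intro x
  obtain ⟨Φ, hx, hΦ⟩ := hf x
  let Ψ := Φ.trans (chartPartialDiffeomorph (f x))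
  have hxs : x ∈ Ψ.source := ⟨hx, by
    change Φ x ∈ (chartAt (EuclideanSpace ℝ (Fin n)) (f x)).source
    rw [← hΦ hx]; exact mem_chart_source _ (f x)⟩
  refine Manifold.IsImmersionAtOfComplement.mk_of_continuousAt
    (hf x).contMDiffAt.continuousAt (ContinuousLinearEquiv.prodUnique ℝ _ PUnit)
    Ψ.toOpenPartialHomeomorph (chartAt (EuclideanSpace ℝ (Fin n)) (f x)) hxs
    (mem_chart_source _ (f x))
    (OpenPartialHomeomorph.mem_maximalAtlas_of_contMDiffOn _ Ψ.contMDiffOn_toFun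
      Ψ.contMDiffOn_invFun) (IsManifold.chart_mem_maximalAtlas _) ?_
  intro y hy
  have hy' : y ∈ Ψ.target := by simpa using hy
  have hz : Ψ.symm y ∈ Ψ.source := Ψ.map_target hy'
  have h1 : f (Ψ.symm y) = Φ (Ψ.symm y) := hΦ hz.1
  have h2 : chartAt (EuclideanSpace ℝ (Fin n)) (f x) (Φ (Ψ.symm y)) = y := Ψ.right_inv hy'
  change chartAt (EuclideanSpace ℝ (Fin n)) (f x) (f (Ψ.symm y)) = y
  rw [h1, h2]

theorem IsLocalDiffeomorph.isSmoothEmbedding {f : M → N}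
    (hf : IsLocalDiffeomorph (𝓡 n) (𝓡 n) ∞ f) (hinj : Function.Injective f) :
    Manifold.IsSmoothEmbedding (𝓡 n) (𝓡 n) ∞ f :=
  ⟨hf.isImmersion, (IsOpenEmbedding.of_continuous_injective_isOpenMap hf.contMDiff.continuous hinj
    hf.isOpenMap).isEmbedding⟩

end LocalDiffeomorph

/-! ### Passing from the punctured manifold to the manifold -/

section Extend

variable {d : ℕ} {M N : Type*} [TopologicalSpace M]
  [ChartedSpace (EuclideanSpace ℝ (Fin (d + 1))) M]
  [TopologicalSpace N] [ChartedSpace (EuclideanSpace ℝ (Fin (d + 1))) N] [T2Space M] {p : M}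
  {ι : puncturedAt p → N} {j : M → N}

/-- An extension of a map off `p` has the same differential off `p`. -/
theorem contMDiffAt_of_eq_puncturedAt (hι : ContMDiff (𝓡 (d + 1)) (𝓡 (d + 1)) ∞ ι)
    (hj : ∀ x : puncturedAt p, j x = ι x) (x : puncturedAt p) :
    ContMDiffAt (𝓡 (d + 1)) (𝓡 (d + 1)) ∞ j (x : M) ∧
      ∀ v : EuclideanSpace ℝ (Fin (d + 1)), mfderiv (𝓡 (d + 1)) (𝓡 (d + 1)) j (x : M)
        (mfderiv (𝓡 (d + 1)) (𝓡 (d + 1)) (Subtype.val : puncturedAt p → M) x v) =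
        mfderiv (𝓡 (d + 1)) (𝓡 (d + 1)) (fun y : puncturedAt p ↦ j y) x v := by
  have hfun : (fun y : puncturedAt p ↦ j y) = ι := funext hj
  have h1 : ContMDiffAt (𝓡 (d + 1)) (𝓡 (d + 1)) ∞ j (x : M) := by
    rw [← contMDiffAt_subtype_iff, hfun]
    exact hι x
  refine ⟨h1, fun v ↦ ?_⟩
  have h2 : MDifferentiableAt (𝓡 (d + 1)) (𝓡 (d + 1)) (Subtype.val : puncturedAt p → M) x :=
    (contMDiff_subtype_val (n := 1) x).mdifferentiableAt (by simp)
  have h3 := mfderiv_comp x (h1.mdifferentiableAt (by simp)) h2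
  exact (DFunLike.congr_fun h3 v).symm

end Extend

/-! ### Metric-preserving maps and charts -/

section Isometries

set_option maxSynthPendingDepth 3

open Set Filter Topology

namespace LorentzianMetric

variable {d : ℕ} {M N : Type*} [TopologicalSpace M]
  [ChartedSpace (EuclideanSpace ℝ (Fin (d + 1))) M]
  [IsManifold (𝓡 (d + 1)) ∞ M]
  [TopologicalSpace N] [ChartedSpace (EuclideanSpace ℝ (Fin (d + 1))) N]
  [IsManifold (𝓡 (d + 1)) ∞ N]

/-- Pairing with the basis vector `b i` isolates the `i`-th coordinate of `v` up to sign. The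
extension over the puncture uses the signature only through this nondegeneracy. -/
theorem eq_zero_of_forall_val_eq_zero (g : LorentzianMetric d M) {x : M}
    {v : TangentSpace (𝓡 (d + 1)) x} (hv : ∀ w, g.val x v w = 0) : v = 0 := by
  obtain ⟨b, hb⟩ := g.signature x
  refine b.ext_elem fun i ↦ ?_
  have h1 := hv (b i)
  rw [← b.sum_repr v, map_sum, sum_apply, Finset.sum_eq_single i] at h1
  · rw [map_smul, smul_apply, hb, if_pos rfl, smul_eq_mul,
      mul_eq_zero] at h1
    rcases h1 with h1 | h1
    · simpa using h1
    · split_ifs at h1 <;> norm_num at h1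
  · intro j _ hj
    rw [map_smul, smul_apply, hb, if_neg hj, smul_zero]
  · simp

theorem injective_of_pullback_eq {g : LorentzianMetric d M} {h : LorentzianMetric d N} {f : M → N}
    {x : M} (hf : ∀ v w, h.val (f x) (mfderiv (𝓡 (d + 1)) (𝓡 (d + 1)) f x v)
      (mfderiv (𝓡 (d + 1)) (𝓡 (d + 1)) f x w) = g.val x v w) :
    Function.Injective (mfderiv (𝓡 (d + 1)) (𝓡 (d + 1)) f x) := by
  rw [injective_iff_map_eq_zero]
  intro v hv
  refine g.eq_zero_of_forall_val_eq_zero fun w ↦ ?_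
  rw [← hf, hv]
  simp

theorem isInvertible_pullbackForm (g : LorentzianMetric d M)
    {f : EuclideanSpace ℝ (Fin (d + 1)) → M} {y : EuclideanSpace ℝ (Fin (d + 1))}
    (hf : Function.Bijective (mfderiv (𝓡 (d + 1)) (𝓡 (d + 1)) f y)) :
    (pullbackForm g.val f y).IsInvertible := by
  refine isInvertible_of_injective ?_
  rw [injective_iff_map_eq_zero]
  intro v hv
  refine (injective_iff_map_eq_zero _).1 hf.1 v (g.eq_zero_of_forall_val_eq_zero fun w ↦ ?_)
  obtain ⟨w, rfl⟩ := hf.2 w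
  exact DFunLike.congr_fun hv w

theorem bijective_mfderiv_chartAt_symm {x : M} {y : EuclideanSpace ℝ (Fin (d + 1))}
    (hy : y ∈ (chartAt (EuclideanSpace ℝ (Fin (d + 1))) x).target) : Function.Bijective
      (mfderiv (𝓡 (d + 1)) (𝓡 (d + 1)) (chartAt (EuclideanSpace ℝ (Fin (d + 1))) x).symm y) := by
  have : IsManifold (𝓡 (d + 1)) 1 M := IsManifold.of_le (n := ∞) ENat.LEInfty.out
  exact (mdifferentiable_chart (I := 𝓡 (d + 1)) x).symm.mfderiv_bijective hy

theorem contDiffOn_pullbackForm_chartAt_symm (g : LorentzianMetric d M) (x : M) :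
    ContDiffOn ℝ ∞ (pullbackForm g.val (chartAt (EuclideanSpace ℝ (Fin (d + 1))) x).symm)
      (chartAt (EuclideanSpace ℝ (Fin (d + 1))) x).target :=
  contDiffOn_pullbackForm g.contMDiff (chartAt _ x).open_target
    (contMDiffOn_symm_of_mem_maximalAtlas (IsManifold.chart_mem_maximalAtlas x))

section Punctured

variable [T2Space M] {p : M} {ι : puncturedAt p → N} {j : M → N}

/-- The inclusion of the punctured manifold has identity derivative in the preferred charts, so the
restricted metric and the differential of `ι` are those of `g` and `j`. -/
theorem val_mfderiv_of_preservesMetric {g : LorentzianMetric d M} {h : LorentzianMetric d N}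
    (hι : ContMDiff (𝓡 (d + 1)) (𝓡 (d + 1)) ∞ ι)
    (hιg : PreservesMetric (g.restrict (puncturedAt p)) h ι)
    (hj : ∀ x : puncturedAt p, j x = ι x) {x : M} (hx : x ≠ p)
    (v w : TangentSpace (𝓡 (d + 1)) x) :
    h.val (j x) (mfderiv (𝓡 (d + 1)) (𝓡 (d + 1)) j x v)
      (mfderiv (𝓡 (d + 1)) (𝓡 (d + 1)) j x w) = g.val x v w := by
  obtain rfl : (fun y : puncturedAt p ↦ j y) = ι := funext hj
  have h1 := hιg ⟨x, hx⟩ v w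
  have h2 := (contMDiffAt_of_eq_puncturedAt hι hj ⟨x, hx⟩).2
  have hid (v : EuclideanSpace ℝ (Fin (d + 1))) :
      mfderiv (𝓡 (d + 1)) (𝓡 (d + 1)) (Subtype.val : puncturedAt p → M) ⟨x, hx⟩ v = v := by
    rw [mfderiv_opens_subtypeVal]; rfl
  have h3 (v : EuclideanSpace ℝ (Fin (d + 1))) : mfderiv (𝓡 (d + 1)) (𝓡 (d + 1)) j x v =
      mfderiv (𝓡 (d + 1)) (𝓡 (d + 1)) (fun y : puncturedAt p ↦ j y) ⟨x, hx⟩ v := by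
    rw [← h2 v]
    exact congrArg (mfderiv (𝓡 (d + 1)) (𝓡 (d + 1)) j x) (hid v).symm
  refine (congrArg₂ (fun a b ↦ h.val (j x) a b) (h3 v) (h3 w)).trans (h1.trans ?_)
  exact congrArg₂ (fun a b ↦ g.val x a b) (hid v) (hid w)

end Punctured

/-- A map preserves the metrics at a point if it does so in a chart. -/
theorem val_mfderiv_of_pullbackForm_eq {g : LorentzianMetric d M} {h : LorentzianMetric d N}
    {j : M → N} {x : M} (hj : MDifferentiableAt (𝓡 (d + 1)) (𝓡 (d + 1)) j x)
    (hx : pullbackForm h.val (j ∘ (chartAt (EuclideanSpace ℝ (Fin (d + 1))) x).symm)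
        (chartAt (EuclideanSpace ℝ (Fin (d + 1))) x x) =
      pullbackForm g.val (chartAt (EuclideanSpace ℝ (Fin (d + 1))) x).symm
        (chartAt (EuclideanSpace ℝ (Fin (d + 1))) x x))
    (v w : TangentSpace (𝓡 (d + 1)) x) :
    h.val (j x) (mfderiv (𝓡 (d + 1)) (𝓡 (d + 1)) j x v)
      (mfderiv (𝓡 (d + 1)) (𝓡 (d + 1)) j x w) = g.val x v w := by
  set χ := chartAt (EuclideanSpace ℝ (Fin (d + 1))) x with hχ
  have hm : χ x ∈ χ.target := χ.map_source (mem_chart_source _ x)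
  have hxx : χ.symm (χ x) = x := χ.left_inv (mem_chart_source _ x)
  have key : ∀ z : M, z = χ.symm (χ x) → MDifferentiableAt (𝓡 (d + 1)) (𝓡 (d + 1)) j z →
      ∀ v w : TangentSpace (𝓡 (d + 1)) z, h.val (j z) (mfderiv (𝓡 (d + 1)) (𝓡 (d + 1)) j z v)
        (mfderiv (𝓡 (d + 1)) (𝓡 (d + 1)) j z w) = g.val z v w := by
    rintro z rfl hz v w
    obtain ⟨v, rfl⟩ := (bijective_mfderiv_chartAt_symm hm).2 v
    obtain ⟨w, rfl⟩ := (bijective_mfderiv_chartAt_symm hm).2 w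
    have h1 := DFunLike.congr_fun (DFunLike.congr_fun hx v) w
    have h2 := mfderiv_comp _ hz (mdifferentiableAt_chartAt_symm hm)
    refine Eq.trans ?_ h1
    refine (congrArg₂ (fun a b ↦ h.val (j (χ.symm (χ x))) a b) ?_ ?_).symm
    · exact DFunLike.congr_fun h2 v
    · exact DFunLike.congr_fun h2 w
  exact key x hxx.symm hj v w

end LorentzianMetric

end Isometries

/-! ### Extension of an isometric embedding to an accumulation point -/

section Reinsertion

set_option maxSynthPendingDepth 3

open Set Filter Topology

namespace LorentzianMetric

variable {d : ℕ} {M N : Type*} [TopologicalSpace M]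
  [ChartedSpace (EuclideanSpace ℝ (Fin (d + 1))) M]
  [IsManifold (𝓡 (d + 1)) ∞ M]
  [TopologicalSpace N] [ChartedSpace (EuclideanSpace ℝ (Fin (d + 1))) N]
  [IsManifold (𝓡 (d + 1)) ∞ N]

theorem PreservesMetric.isLocalDiffeomorph {g : LorentzianMetric d M} {h : LorentzianMetric d N}
    {f : M → N} (hg : PreservesMetric g h f) (hf : ContMDiff (𝓡 (d + 1)) (𝓡 (d + 1)) ∞ f) :
    IsLocalDiffeomorph (𝓡 (d + 1)) (𝓡 (d + 1)) ∞ f :=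
  isLocalDiffeomorph_of_injective_mfderiv hf fun x ↦ injective_of_pullback_eq (hg x)

variable [T2Space M] {p : M} {ι : puncturedAt p → N} {j : M → N}

/-- An accumulation point of an open injective map at the removed point is not in its range. -/
theorem apply_ne_of_accumulation (hι : IsOpenMap ι) (hinj : Function.Injective ι)
    (hj : ∀ x : puncturedAt p, j x = ι x)
    (hcl : ∀ U ∈ 𝓝 p, ∀ V ∈ 𝓝 (j p), ∃ x ≠ p, x ∈ U ∧ j x ∈ V) {x : M} (hx : x ≠ p) :
    j x ≠ j p := by
  intro hxp
  -- If `j x = j p`, the image of `U` is a neighbourhood of `j p`, so some point of `V` has the same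
  -- image as a point of `U`, against injectivity.
  obtain ⟨U, V, hU, hV, hxU, hpV, hd⟩ := t2_separation hx
  have h1 : ι '' (Subtype.val ⁻¹' U) ∈ 𝓝 (j p) := by
    refine (hι _ (hU.preimage continuous_subtype_val)).mem_nhds ?_
    exact ⟨⟨x, hx⟩, hxU, by rw [← hj, hxp]⟩
  obtain ⟨z, hzp, hzV, u, huU, huz⟩ := hcl V (hV.mem_nhds hpV) _ h1
  have h2 : ι u = ι ⟨z, hzp⟩ := huz.trans (hj ⟨z, hzp⟩)
  have h3 : (u : M) = z := congrArg Subtype.val (hinj h2)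
  exact disjoint_left.1 hd huU (h3 ▸ hzV)

/-- The bridge to the calculus in the model space, with charts at `p` and at an arbitrary `q`;
nothing is assumed about `j p`. -/
theorem isPuncturedIsometry_of_preservesMetric {g : LorentzianMetric d M}
    {h : LorentzianMetric d N} (hι : ContMDiff (𝓡 (d + 1)) (𝓡 (d + 1)) ∞ ι)
    (hιg : PreservesMetric (g.restrict (puncturedAt p)) h ι)
    (hj : ∀ x : puncturedAt p, j x = ι x) (q : N) :
    IsPuncturedIsometry (chartAt (EuclideanSpace ℝ (Fin (d + 1))) p).target
      (chartAt (EuclideanSpace ℝ (Fin (d + 1))) p p)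
      (pullbackForm g.val (chartAt (EuclideanSpace ℝ (Fin (d + 1))) p).symm)
      (chartAt (EuclideanSpace ℝ (Fin (d + 1))) q)
      (pullbackForm h.val (chartAt (EuclideanSpace ℝ (Fin (d + 1))) q).symm)
      (j ∘ (chartAt (EuclideanSpace ℝ (Fin (d + 1))) p).symm) := by
  set χ := chartAt (EuclideanSpace ℝ (Fin (d + 1))) p with hχ
  set φ := chartAt (EuclideanSpace ℝ (Fin (d + 1))) q with hφ
  have hne : ∀ x ∈ χ.target \ {χ p}, χ.symm x ≠ p := by
    intro x hx hxp
    refine hx.2 ?_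
    rw [mem_singleton_iff, ← χ.right_inv hx.1, hxp]
  have hjs : ∀ x : M, x ≠ p → ContMDiffAt (𝓡 (d + 1)) (𝓡 (d + 1)) ∞ j x := fun x hx ↦
    (contMDiffAt_of_eq_puncturedAt hι hj ⟨x, hx⟩).1
  have hχs : ∀ x ∈ χ.target, ContMDiffAt (𝓡 (d + 1)) (𝓡 (d + 1)) ∞ χ.symm x := fun x hx ↦
    contMDiffAt_symm_of_mem_maximalAtlas (IsManifold.chart_mem_maximalAtlas p) hx
  have hks : ∀ x ∈ χ.target \ {χ p}, ContMDiffAt (𝓡 (d + 1)) (𝓡 (d + 1)) ∞ (j ∘ χ.symm) x :=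
    fun x hx ↦ (hjs _ (hne x hx)).comp x (hχs x hx.1)
  have hφk : ∀ x ∈ χ.target \ {χ p}, (j ∘ χ.symm) x ∈ φ.source →
      ContDiffAt ℝ ∞ (φ ∘ (j ∘ χ.symm)) x := by
    intro x hx hxs
    refine ContMDiffAt.contDiffAt (ContMDiffAt.comp x ?_ (hks x hx))
    exact contMDiffAt_of_mem_maximalAtlas (IsManifold.chart_mem_maximalAtlas q) hxs
  refine
    { isOpen := χ.open_target
      mem := χ.map_source (mem_chart_source _ p)
      contDiffOn_left := contDiffOn_pullbackForm_chartAt_symm g p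
      isInvertible_left := fun x hx ↦
        isInvertible_pullbackForm g (bijective_mfderiv_chartAt_symm hx)
      contDiffOn_right := contDiffOn_pullbackForm_chartAt_symm h q
      isInvertible_right := fun x hx ↦
        isInvertible_pullbackForm h (bijective_mfderiv_chartAt_symm hx)
      symm_right := fun y _ v w ↦ h.symm _ _ _
      continuousOn := fun x hx ↦ (hks x hx).continuousAt.continuousWithinAt
      contDiffAt := hφk
      pullback_eq := ?_ }
  intro x hx hxs v w
  have h1 : φ.symm ∘ (φ ∘ (j ∘ χ.symm)) =ᶠ[𝓝 x] j ∘ χ.symm := by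
    filter_upwards [(hks x hx).continuousAt.preimage_mem_nhds (φ.open_source.mem_nhds hxs)]
      with y hy
    exact φ.left_inv hy
  have h2 := h1.pullbackForm_eq h.val
  have h3 := pullbackForm_comp_fderiv h.val (f := φ.symm) (b := φ ∘ (j ∘ χ.symm)) (y := x)
    (mdifferentiableAt_chartAt_symm (φ.map_source hxs))
    ((hφk x hx hxs).differentiableAt (by simp)) v w
  have h4 := pullbackForm_comp_mfderiv (B := g.val) (B' := h.val) (f := χ.symm) (j := j) (y := x)
    ((hjs _ (hne x hx)).mdifferentiableAt (by simp)) (mdifferentiableAt_chartAt_symm hx.1)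
    (val_mfderiv_of_preservesMetric hι hιg hj (hne x hx))
  refine h3.symm.trans ?_
  rw [h2, h4]

/-- An isometric embedding of a punctured Lorentzian manifold extends to the removed point as soon
as it has an accumulation point there. -/
theorem contMDiff_and_preservesMetric_of_accumulation [T2Space N] {g : LorentzianMetric d M}
    {h : LorentzianMetric d N} (hd : 1 ≤ d) (hι : ContMDiff (𝓡 (d + 1)) (𝓡 (d + 1)) ∞ ι)
    (hιg : PreservesMetric (g.restrict (puncturedAt p)) h ι) (hinj : Function.Injective ι)
    (hj : ∀ x : puncturedAt p, j x = ι x)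
    (hcl : ∀ U ∈ 𝓝 p, ∀ V ∈ 𝓝 (j p), ∃ x ≠ p, x ∈ U ∧ j x ∈ V) :
    ContMDiff (𝓡 (d + 1)) (𝓡 (d + 1)) ∞ j ∧ PreservesMetric g h j := by
  have hiso := isPuncturedIsometry_of_preservesMetric hι hιg hj (j p)
  set χ := chartAt (EuclideanSpace ℝ (Fin (d + 1))) p with hχ
  set φ := chartAt (EuclideanSpace ℝ (Fin (d + 1))) (j p) with hφ
  have hpχ : p ∈ χ.source := mem_chart_source _ p
  have hpφ : j p ∈ φ.source := mem_chart_source _ (j p)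
  have hq : φ (j p) ∈ φ.target := φ.map_source hpφ
  have hqs : φ.symm (φ (j p)) = j p := φ.left_inv hpφ
  have hne : ∀ x ∈ χ.target \ {χ p}, χ.symm x ≠ p := by
    intro x hx hxp
    refine hx.2 ?_
    rw [mem_singleton_iff, ← χ.right_inv hx.1, hxp]
  have hrank : 1 < Module.rank ℝ (EuclideanSpace ℝ (Fin (d + 1))) := by
    rw [← Module.finrank_eq_rank, finrank_euclideanSpace, Fintype.card_fin]
    exact_mod_cast Nat.lt_succ_of_le hd
  have hqk : ∀ x ∈ χ.target \ {χ p}, (j ∘ χ.symm) x ≠ φ.symm (φ (j p)) := by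
    intro x hx
    rw [hqs]
    exact apply_ne_of_accumulation (hιg.isLocalDiffeomorph hι).isOpenMap hinj hj hcl (hne x hx)
  have hcl' : ∀ η > (0 : ℝ), ∃ x ∈ χ.target \ {χ p}, x ∈ Metric.ball (χ p) η ∧
      (j ∘ χ.symm) x ∈ φ.source ∧ φ ((j ∘ χ.symm) x) ∈ Metric.ball (φ (j p)) η := by
    intro η hη
    have hU : χ.source ∩ χ ⁻¹' Metric.ball (χ p) η ∈ 𝓝 p :=
      inter_mem (χ.open_source.mem_nhds hpχ)
        ((χ.continuousAt hpχ).preimage_mem_nhds (Metric.ball_mem_nhds _ hη))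
    have hV : φ.source ∩ φ ⁻¹' Metric.ball (φ (j p)) η ∈ 𝓝 (j p) :=
      inter_mem (φ.open_source.mem_nhds hpφ)
        ((φ.continuousAt hpφ).preimage_mem_nhds (Metric.ball_mem_nhds _ hη))
    obtain ⟨x, hxp, hxU, hxV⟩ := hcl _ hU _ hV
    refine ⟨χ x, ⟨χ.map_source hxU.1, fun hx ↦ hxp (χ.injOn hxU.1 hpχ hx)⟩, hxU.2, ?_⟩
    simp only [Function.comp_apply, χ.left_inv hxU.1]
    exact hxV
  have htend := hiso.tendsto_punctured hrank hq hqk hcl'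
  classical
  obtain ⟨hsm, hmet⟩ := hiso.contDiffAt_update hrank hq hqk hcl'
  -- `j p` already is the accumulation point, so the extension in the chart is `j` itself.
  have hup : Function.update (φ ∘ (j ∘ χ.symm)) (χ p) (φ (j p)) = φ ∘ (j ∘ χ.symm) := by
    refine Function.update_eq_self_iff.2 ?_
    simp [χ.left_inv hpχ]
  rw [hup] at hsm hmet
  rw [hqs] at htend
  have hkc : ContinuousAt (j ∘ χ.symm) (χ p) := by
    rw [continuousAt_iff_punctured_nhds]
    simpa [χ.left_inv hpχ] using htend
  have hjc : ContinuousAt j p := by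
    have h1 : ContinuousAt ((j ∘ χ.symm) ∘ χ) p := hkc.comp (χ.continuousAt hpχ)
    refine h1.congr ?_
    filter_upwards [χ.open_source.mem_nhds hpχ] with x hx
    simp [χ.left_inv hx]
  have hjp : ContMDiffAt (𝓡 (d + 1)) (𝓡 (d + 1)) ∞ j p := by
    rw [contMDiffAt_iff]
    refine ⟨hjc, ?_⟩
    simpa [ModelWithCorners.range_eq_univ, contDiffWithinAt_univ, hχ, hφ, Function.comp_def]
      using hsm
  refine ⟨fun x ↦ ?_, fun x ↦ ?_⟩
  · by_cases hx : x = p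
    · exact hx ▸ hjp
    · exact (contMDiffAt_of_eq_puncturedAt hι hj ⟨x, hx⟩).1
  · by_cases hx : x = p
    · subst hx
      refine val_mfderiv_of_pullbackForm_eq (hjp.mdifferentiableAt (by simp)) ?_
      have h1 : φ.symm ∘ (φ ∘ (j ∘ χ.symm)) =ᶠ[𝓝 (χ x)] j ∘ χ.symm := by
        have hxs : (j ∘ χ.symm) (χ x) ∈ φ.source := by simpa [χ.left_inv hpχ] using hpφ
        filter_upwards [hkc.preimage_mem_nhds (φ.open_source.mem_nhds hxs)] with y hy
        exact φ.left_inv hy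
      refine (h1.pullbackForm_eq h.val).symm.trans ?_
      have hb : (φ ∘ (j ∘ χ.symm)) (χ x) = φ (j x) := by simp [χ.left_inv hpχ]
      ext v w
      refine (pullbackForm_comp_fderiv h.val (f := φ.symm) (b := φ ∘ (j ∘ χ.symm)) (y := χ x)
        (by rw [hb]; exact mdifferentiableAt_chartAt_symm hq)
        (hsm.differentiableAt (by simp)) v w).trans ?_
      rw [hb]
      exact hmet v w
    · exact val_mfderiv_of_preservesMetric hι hιg hj hx

theorem injective_of_accumulation (hι : IsOpenMap ι) (hinj : Function.Injective ι)
    (hj : ∀ x : puncturedAt p, j x = ι x)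
    (hcl : ∀ U ∈ 𝓝 p, ∀ V ∈ 𝓝 (j p), ∃ x ≠ p, x ∈ U ∧ j x ∈ V) : Function.Injective j := by
  intro x y hxy
  by_cases hx : x = p
  · by_cases hy : y = p
    · rw [hx, hy]
    · exact absurd (hx ▸ hxy.symm) (apply_ne_of_accumulation hι hinj hj hcl hy)
  · by_cases hy : y = p
    · exact absurd (hy ▸ hxy) (apply_ne_of_accumulation hι hinj hj hcl hx)
    · have h1 : ι ⟨x, hx⟩ = ι ⟨y, hy⟩ := (hj ⟨x, hx⟩).symm.trans (hxy.trans (hj ⟨y, hy⟩))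
      exact congrArg Subtype.val (hinj h1)

end LorentzianMetric

/-- An inextendible Lorentzian manifold exhausts every connected one in which it embeds
isometrically. -/
theorem LorentzianMetric.IsInextendible.surjective {d : ℕ} {M N : Type u} [TopologicalSpace M]
    [ChartedSpace (EuclideanSpace ℝ (Fin (d + 1))) M] [IsManifold (𝓡 (d + 1)) ∞ M] [Nonempty M]
    [TopologicalSpace N] [ChartedSpace (EuclideanSpace ℝ (Fin (d + 1))) N]
    [IsManifold (𝓡 (d + 1)) ∞ N] [T2Space N] [SecondCountableTopology N] [ConnectedSpace N]
    {g : LorentzianMetric d M} {h : LorentzianMetric d N} (hg : g.IsInextendible) {f : M → N}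
    (hf : ContMDiff (𝓡 (d + 1)) (𝓡 (d + 1)) ∞ f) (hfg : PreservesMetric g h f)
    (hinj : Function.Injective f) : Function.Surjective f := by
  have hloc := hfg.isLocalDiffeomorph hf
  have hfr : ¬ (frontier (range f)).Nonempty := fun hne ↦
    hg N h f ⟨hloc.isSmoothEmbedding hinj, hfg, hne⟩
  rw [not_nonempty_iff_eq_empty] at hfr
  exact range_eq_univ.1 ((isClopen_iff_frontier_eq_empty.2 hfr).eq_univ (range_nonempty f))

end Reinsertion

/-! ### Smooth structure on a space covered by two manifolds -/

section Cover

set_option maxSynthPendingDepth 3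

open Set Filter Topology

/-- Charts on a space covered by open subsets of two charted spaces. -/
@[reducible] noncomputable def ChartedSpace.ofCover {H X M N : Type*} [TopologicalSpace H]
    [TopologicalSpace X] [TopologicalSpace M] [ChartedSpace H M] [TopologicalSpace N]
    [ChartedSpace H N] (α : OpenPartialHomeomorph X M) (β : OpenPartialHomeomorph X N)
    (hcov : ∀ x, x ∈ α.source ∨ x ∈ β.source) : ChartedSpace H X where
  atlas := (range fun y : M ↦ α.trans (chartAt H y)) ∪ range fun y : N ↦ β.trans (chartAt H y)
  chartAt x := by
    classical
    exact if x ∈ α.source then α.trans (chartAt H (α x)) else β.trans (chartAt H (β x))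
  mem_chart_source x := by
    split_ifs with hx
    · simp [hx]
    · simp [(hcov x).resolve_left hx]
  chart_mem_atlas x := by
    split_ifs
    · exact Or.inl ⟨_, rfl⟩
    · exact Or.inr ⟨_, rfl⟩

variable {d : ℕ} {X M N : Type*} [TopologicalSpace X] [TopologicalSpace M]
  [ChartedSpace (EuclideanSpace ℝ (Fin (d + 1))) M]
  [TopologicalSpace N] [ChartedSpace (EuclideanSpace ℝ (Fin (d + 1))) N]

theorem contMDiffOn_comp_symm_self (α : OpenPartialHomeomorph X M) :
    ContMDiffOn (𝓡 (d + 1)) (𝓡 (d + 1)) ∞ (α ∘ α.symm) (α.symm.trans α).source :=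
  contMDiffOn_id.congr fun _ hz ↦ α.right_inv hz.1

variable [IsManifold (𝓡 (d + 1)) ∞ M] [IsManifold (𝓡 (d + 1)) ∞ N]

/-- A transition map is `β ∘ α.symm` conjugated by charts of `M` and `N`. The case `β = α` covers
charts coming from the same piece. -/
theorem contDiffOn_trans_chartAt (α : OpenPartialHomeomorph X M) (β : OpenPartialHomeomorph X N)
    (h : ContMDiffOn (𝓡 (d + 1)) (𝓡 (d + 1)) ∞ (β ∘ α.symm) (α.symm.trans β).source)
    (x : M) (y : N) :
    ContDiffOn ℝ ∞ ((α.trans (chartAt (EuclideanSpace ℝ (Fin (d + 1))) x)).symm.trans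
        (β.trans (chartAt (EuclideanSpace ℝ (Fin (d + 1))) y)))
      ((α.trans (chartAt (EuclideanSpace ℝ (Fin (d + 1))) x)).symm.trans
        (β.trans (chartAt (EuclideanSpace ℝ (Fin (d + 1))) y))).source := by
  set χ := chartAt (EuclideanSpace ℝ (Fin (d + 1))) x
  set φ := chartAt (EuclideanSpace ℝ (Fin (d + 1))) y
  have hχ : ContMDiffOn (𝓡 (d + 1)) (𝓡 (d + 1)) ∞ χ.symm χ.target :=
    contMDiffOn_symm_of_mem_maximalAtlas (IsManifold.chart_mem_maximalAtlas x)
  have hφ : ContMDiffOn (𝓡 (d + 1)) (𝓡 (d + 1)) ∞ φ φ.source :=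
    contMDiffOn_of_mem_maximalAtlas (IsManifold.chart_mem_maximalAtlas y)
  refine ContMDiffOn.contDiffOn ?_
  have hm : ∀ z ∈ ((α.trans χ).symm.trans (β.trans φ)).source, z ∈ χ.target ∧
      χ.symm z ∈ α.target ∧ α.symm (χ.symm z) ∈ β.source ∧
      β (α.symm (χ.symm z)) ∈ φ.source := by
    intro z hz
    simp only [OpenPartialHomeomorph.trans_source, OpenPartialHomeomorph.symm_source,
      OpenPartialHomeomorph.trans_target, mem_inter_iff, mem_preimage,
      OpenPartialHomeomorph.coe_trans_symm, Function.comp_apply] at hz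
    exact ⟨hz.1.1, hz.1.2, hz.2.1, hz.2.2⟩
  refine hφ.comp (h.comp (hχ.mono fun z hz ↦ (hm z hz).1) fun z hz ↦ ?_) fun z hz ↦
    (hm z hz).2.2.2
  exact ⟨(hm z hz).2.1, (hm z hz).2.2.1⟩

theorem isManifold_ofCover (α : OpenPartialHomeomorph X M) (β : OpenPartialHomeomorph X N)
    (hcov : ∀ x, x ∈ α.source ∨ x ∈ β.source)
    (h : ContMDiffOn (𝓡 (d + 1)) (𝓡 (d + 1)) ∞ (β ∘ α.symm) (α.symm.trans β).source)
    (h' : ContMDiffOn (𝓡 (d + 1)) (𝓡 (d + 1)) ∞ (α ∘ β.symm) (β.symm.trans α).source) :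
    @IsManifold ℝ _ _ _ _ _ _ (𝓡 (d + 1)) ∞ X _
      (ChartedSpace.ofCover (H := EuclideanSpace ℝ (Fin (d + 1))) α β hcov) := by
  let _ := ChartedSpace.ofCover (H := EuclideanSpace ℝ (Fin (d + 1))) α β hcov
  refine isManifold_of_contDiffOn _ _ _ fun e e' he he' ↦ ?_
  suffices h : ContDiffOn ℝ ∞ (e.symm.trans e') (e.symm.trans e').source by
    simpa [ModelWithCorners.range_eq_univ] using h
  rcases he with ⟨x, rfl⟩ | ⟨x, rfl⟩ <;> rcases he' with ⟨y, rfl⟩ | ⟨y, rfl⟩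
  · exact contDiffOn_trans_chartAt α α (contMDiffOn_comp_symm_self α) x y
  · exact contDiffOn_trans_chartAt α β h x y
  · exact contDiffOn_trans_chartAt β α h' x y
  · exact contDiffOn_trans_chartAt β β (contMDiffOn_comp_symm_self β) x y

/-- Locally `α` is a chart of `X` followed by the inverse of a chart of `M`, and dually for
`α.symm`. -/
theorem contMDiffOn_of_forall_trans_chartAt_mem_atlas
    [ChartedSpace (EuclideanSpace ℝ (Fin (d + 1))) X] [IsManifold (𝓡 (d + 1)) ∞ X]
    (α : OpenPartialHomeomorph X M)
    (hα : ∀ y : M, α.trans (chartAt (EuclideanSpace ℝ (Fin (d + 1))) y) ∈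
      atlas (EuclideanSpace ℝ (Fin (d + 1))) X) :
    ContMDiffOn (𝓡 (d + 1)) (𝓡 (d + 1)) ∞ α α.source ∧
      ContMDiffOn (𝓡 (d + 1)) (𝓡 (d + 1)) ∞ α.symm α.target := by
  constructor
  · intro x hx
    set χ := chartAt (EuclideanSpace ℝ (Fin (d + 1))) (α x) with hχ
    have hxχ : α x ∈ χ.source := mem_chart_source _ _
    have he := IsManifold.subset_maximalAtlas (I := 𝓡 (d + 1)) (n := ∞) (hα (α x))
    have h1 : ContMDiffAt (𝓡 (d + 1)) (𝓡 (d + 1)) ∞ (α.trans χ) x :=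
      contMDiffAt_of_mem_maximalAtlas he (by simp [hx, hxχ])
    have h2 : ContMDiffAt (𝓡 (d + 1)) (𝓡 (d + 1)) ∞ χ.symm ((α.trans χ) x) :=
      contMDiffAt_symm_of_mem_maximalAtlas (IsManifold.chart_mem_maximalAtlas (α x))
        (χ.map_source hxχ)
    refine ((h2.comp x h1).congr_of_eventuallyEq ?_).contMDiffWithinAt
    filter_upwards [(α.continuousAt hx).preimage_mem_nhds (χ.open_source.mem_nhds hxχ)] with z hz
    exact (χ.left_inv hz).symm
  · intro y hy
    set χ := chartAt (EuclideanSpace ℝ (Fin (d + 1))) y with hχ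
    have hyχ : y ∈ χ.source := mem_chart_source _ _
    have he := IsManifold.subset_maximalAtlas (I := 𝓡 (d + 1)) (n := ∞) (hα y)
    have h1 : ContMDiffAt (𝓡 (d + 1)) (𝓡 (d + 1)) ∞ χ y :=
      contMDiffAt_of_mem_maximalAtlas (IsManifold.chart_mem_maximalAtlas y) hyχ
    have h2 : ContMDiffAt (𝓡 (d + 1)) (𝓡 (d + 1)) ∞ (α.trans χ).symm (χ y) :=
      contMDiffAt_symm_of_mem_maximalAtlas he (by simp [χ.map_source hyχ, χ.left_inv hyχ, hy])
    refine ((h2.comp y h1).congr_of_eventuallyEq ?_).contMDiffWithinAt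
    filter_upwards [χ.open_source.mem_nhds hyχ] with z hz
    simp [χ.left_inv hz]

end Cover

/-! ### Gluing Lorentzian metrics -/

section PullbackMetric

set_option maxSynthPendingDepth 3

open Set Filter Topology

namespace LorentzianMetric

variable {d : ℕ} {X M N : Type*} [TopologicalSpace X]
  [ChartedSpace (EuclideanSpace ℝ (Fin (d + 1))) X] [TopologicalSpace M]
  [ChartedSpace (EuclideanSpace ℝ (Fin (d + 1))) M] [IsManifold (𝓡 (d + 1)) ∞ M]
  [TopologicalSpace N] [ChartedSpace (EuclideanSpace ℝ (Fin (d + 1))) N]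
  [IsManifold (𝓡 (d + 1)) ∞ N]

/-- The pullback of a metric under a map, as a field of bilinear forms. -/
noncomputable def pullbackVal (g : LorentzianMetric d M) (f : X → M) (x : X) :
    TangentSpace (𝓡 (d + 1)) x →L[ℝ] TangentSpace (𝓡 (d + 1)) x →L[ℝ] ℝ :=
  (ContinuousLinearMap.precomp ℝ (mfderiv (𝓡 (d + 1)) (𝓡 (d + 1)) f x)).comp
    ((g.val (f x)).comp (mfderiv (𝓡 (d + 1)) (𝓡 (d + 1)) f x))

theorem exists_basis_of_pullback_eq (g : LorentzianMetric d M) {f : X → M} {x : X}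
    (hf : IsLocalDiffeomorphAt (𝓡 (d + 1)) (𝓡 (d + 1)) ∞ f x) :
    ∃ b : Module.Basis (Fin (d + 1)) ℝ (TangentSpace (𝓡 (d + 1)) x), ∀ i j,
      g.val (f x) (mfderiv (𝓡 (d + 1)) (𝓡 (d + 1)) f x (b i))
        (mfderiv (𝓡 (d + 1)) (𝓡 (d + 1)) f x (b j)) = if i = j then (if i = 0 then -1 else 1) else 0 := by
  obtain ⟨b, hb⟩ := g.signature (f x)
  let A := hf.mfderivToContinuousLinearEquiv (by simp)
  have hA (v : TangentSpace (𝓡 (d + 1)) (f x)) :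
      mfderiv (𝓡 (d + 1)) (𝓡 (d + 1)) f x (A.symm v) = v := A.apply_symm_apply v
  refine ⟨b.map A.symm.toLinearEquiv, fun i j ↦ ?_⟩
  have hbi (i) : (b.map A.symm.toLinearEquiv) i = A.symm (b i) := b.map_apply _ i
  rw [hbi, hbi, hA, hA]
  exact hb i j

/-- In a chart `χ` of `X` the form `B` is the pullback of `g` under `f ∘ χ.symm`, whose smoothness
is known. -/
theorem contMDiffAt_of_pullback_eq [IsManifold (𝓡 (d + 1)) ∞ X] {g : LorentzianMetric d M}
    {B : ∀ x : X, TangentSpace (𝓡 (d + 1)) x →L[ℝ] TangentSpace (𝓡 (d + 1)) x →L[ℝ] ℝ}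
    {f : X → M} {s : Set X} (hs : IsOpen s) (hf : ContMDiffOn (𝓡 (d + 1)) (𝓡 (d + 1)) ∞ f s)
    (hB : ∀ x ∈ s, ∀ v w, g.val (f x) (mfderiv (𝓡 (d + 1)) (𝓡 (d + 1)) f x v)
      (mfderiv (𝓡 (d + 1)) (𝓡 (d + 1)) f x w) = B x v w) {x₀ : X} (hx₀ : x₀ ∈ s) :
    ContMDiffAt (𝓡 (d + 1))
      ((𝓡 (d + 1)).prod 𝓘(ℝ, EuclideanSpace ℝ (Fin (d + 1)) →L[ℝ]
        EuclideanSpace ℝ (Fin (d + 1)) →L[ℝ] ℝ)) ∞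
      (fun x ↦ Bundle.TotalSpace.mk' (EuclideanSpace ℝ (Fin (d + 1)) →L[ℝ]
        EuclideanSpace ℝ (Fin (d + 1)) →L[ℝ] ℝ) x (B x)) x₀ := by
  refine contMDiffAt_of_contDiffAt_pullbackForm ?_
  set χ := chartAt (EuclideanSpace ℝ (Fin (d + 1))) x₀ with hχ
  have hχs : ContMDiffOn (𝓡 (d + 1)) (𝓡 (d + 1)) ∞ χ.symm χ.target :=
    contMDiffOn_symm_of_mem_maximalAtlas (IsManifold.chart_mem_maximalAtlas x₀)
  have hO : IsOpen (χ.target ∩ χ.symm ⁻¹' s) := χ.symm.isOpen_inter_preimage hs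
  have h1 : ContDiffOn ℝ ∞ (pullbackForm g.val (f ∘ χ.symm)) (χ.target ∩ χ.symm ⁻¹' s) :=
    contDiffOn_pullbackForm g.contMDiff hO
      (hf.comp (hχs.mono inter_subset_left) fun y hy ↦ hy.2)
  have hm : χ x₀ ∈ χ.target ∩ χ.symm ⁻¹' s := by
    refine ⟨χ.map_source (mem_chart_source _ x₀), ?_⟩
    simpa [hχ] using hx₀
  refine (h1.congr fun y hy ↦ ?_).contDiffAt (hO.mem_nhds hm)
  exact (pullbackForm_comp_mfderiv
    ((hf.contMDiffAt (hs.mem_nhds hy.2)).mdifferentiableAt (by simp))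
    (mdifferentiableAt_chartAt_symm hy.1) (hB _ hy.2)).symm

/-- Metrics on the members of an open cover by two coordinate domains glue if the transition map
preserves them. -/
theorem exists_of_cover [IsManifold (𝓡 (d + 1)) ∞ X] (g : LorentzianMetric d M)
    (h : LorentzianMetric d N) {α : OpenPartialHomeomorph X M} {β : OpenPartialHomeomorph X N}
    (hcov : ∀ x, x ∈ α.source ∨ x ∈ β.source)
    (hα : ContMDiffOn (𝓡 (d + 1)) (𝓡 (d + 1)) ∞ α α.source)
    (hα' : ContMDiffOn (𝓡 (d + 1)) (𝓡 (d + 1)) ∞ α.symm α.target)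
    (hβ : ContMDiffOn (𝓡 (d + 1)) (𝓡 (d + 1)) ∞ β β.source)
    (hβ' : ContMDiffOn (𝓡 (d + 1)) (𝓡 (d + 1)) ∞ β.symm β.target) {j : M → N}
    (hj : ∀ x ∈ α.source ∩ β.source, β x = j (α x) ∧
      MDifferentiableAt (𝓡 (d + 1)) (𝓡 (d + 1)) j (α x) ∧
      ∀ v w, h.val (j (α x)) (mfderiv (𝓡 (d + 1)) (𝓡 (d + 1)) j (α x) v)
        (mfderiv (𝓡 (d + 1)) (𝓡 (d + 1)) j (α x) w) = g.val (α x) v w) :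
    ∃ k : LorentzianMetric d X, ∀ x ∈ α.source, ∀ v w,
      g.val (α x) (mfderiv (𝓡 (d + 1)) (𝓡 (d + 1)) α x v)
        (mfderiv (𝓡 (d + 1)) (𝓡 (d + 1)) α x w) = k.val x v w := by
  classical
  -- Priority is given to `α`; on the overlap `β = j ∘ α` with `j` isometric, so both descriptions
  -- agree.
  let B : ∀ x : X, TangentSpace (𝓡 (d + 1)) x →L[ℝ] TangentSpace (𝓡 (d + 1)) x →L[ℝ] ℝ := fun x ↦
    if x ∈ α.source then g.pullbackVal α x else h.pullbackVal β x
  have hBα : ∀ x ∈ α.source, ∀ v w, g.val (α x) (mfderiv (𝓡 (d + 1)) (𝓡 (d + 1)) α x v)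
      (mfderiv (𝓡 (d + 1)) (𝓡 (d + 1)) α x w) = B x v w := by
    intro x hx v w
    simp only [B, if_pos hx]
    rfl
  have hBβ : ∀ x ∈ β.source, ∀ v w, h.val (β x) (mfderiv (𝓡 (d + 1)) (𝓡 (d + 1)) β x v)
      (mfderiv (𝓡 (d + 1)) (𝓡 (d + 1)) β x w) = B x v w := by
    intro x hx v w
    by_cases hxα : x ∈ α.source
    · rw [← hBα x hxα]
      obtain ⟨h1, h2, h3⟩ := hj x ⟨hxα, hx⟩
      rw [← h3]
      have h4 : β =ᶠ[𝓝 x] j ∘ α := by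
        filter_upwards [(α.open_source.inter β.open_source).mem_nhds ⟨hxα, hx⟩] with z hz
        exact (hj z hz).1
      have h5 := h4.mfderiv_eq (I := 𝓡 (d + 1)) (I' := 𝓡 (d + 1))
      have h6 := mfderiv_comp x h2
        ((hα.contMDiffAt (α.open_source.mem_nhds hxα)).mdifferentiableAt (by simp))
      have key : ∀ (y y' : N) (_ : y = y') (a b : EuclideanSpace ℝ (Fin (d + 1))),
          h.val y a b = h.val y' a b := by
        rintro y _ rfl a b; rfl
      refine (key _ _ h1 _ _).trans ?_
      have h7 (v : EuclideanSpace ℝ (Fin (d + 1))) : mfderiv (𝓡 (d + 1)) (𝓡 (d + 1)) β x v =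
          mfderiv (𝓡 (d + 1)) (𝓡 (d + 1)) j (α x) (mfderiv (𝓡 (d + 1)) (𝓡 (d + 1)) α x v) :=
        (DFunLike.congr_fun h5 v).trans (DFunLike.congr_fun h6 v)
      exact congrArg₂ (fun a b ↦ h.val (j (α x)) a b) (h7 v) (h7 w)
    · simp only [B, if_neg hxα]
      rfl
  let Φα : PartialDiffeomorph (𝓡 (d + 1)) (𝓡 (d + 1)) X M ∞ :=
    ⟨α.toPartialEquiv, α.open_source, α.open_target, hα, hα'⟩
  let Φβ : PartialDiffeomorph (𝓡 (d + 1)) (𝓡 (d + 1)) X N ∞ :=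
    ⟨β.toPartialEquiv, β.open_source, β.open_target, hβ, hβ'⟩
  refine ⟨⟨B, fun x v w ↦ ?_, fun x ↦ ?_, fun x ↦ ?_⟩, hBα⟩
  · rcases hcov x with hx | hx
    · rw [← hBα x hx, ← hBα x hx, g.symm]
    · rw [← hBβ x hx, ← hBβ x hx, h.symm]
  · rcases hcov x with hx | hx
    · obtain ⟨b, hb⟩ := g.exists_basis_of_pullback_eq (f := α) (x := x) ⟨Φα, hx, fun _ _ ↦ rfl⟩
      exact ⟨b, fun i j ↦ (hBα x hx _ _).symm.trans (hb i j)⟩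
    · obtain ⟨b, hb⟩ := h.exists_basis_of_pullback_eq (f := β) (x := x) ⟨Φβ, hx, fun _ _ ↦ rfl⟩
      exact ⟨b, fun i j ↦ (hBβ x hx _ _).symm.trans (hb i j)⟩
  · rcases hcov x with hx | hx
    · exact contMDiffAt_of_pullback_eq α.open_source hα hBα hx
    · exact contMDiffAt_of_pullback_eq β.open_source hβ hBβ hx

/-- The inverse of a local isometry is a local isometry. -/
theorem preservesMetric_symm_of_target_eq_univ [IsManifold (𝓡 (d + 1)) ∞ X]
    {g : LorentzianMetric d M} {k : LorentzianMetric d X} {α : OpenPartialHomeomorph X M}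
    (hα : ContMDiffOn (𝓡 (d + 1)) (𝓡 (d + 1)) ∞ α α.source)
    (hα' : ContMDiffOn (𝓡 (d + 1)) (𝓡 (d + 1)) ∞ α.symm α.target) (ht : α.target = univ)
    (hk : ∀ x ∈ α.source, ∀ v w, g.val (α x) (mfderiv (𝓡 (d + 1)) (𝓡 (d + 1)) α x v)
      (mfderiv (𝓡 (d + 1)) (𝓡 (d + 1)) α x w) = k.val x v w) :
    PreservesMetric g k α.symm := by
  intro y v w
  have hy : y ∈ α.target := ht ▸ mem_univ y
  have hys := α.map_target hy
  rw [← hk _ hys]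
  have h1 := mfderiv_comp y
    ((hα.contMDiffAt (α.open_source.mem_nhds hys)).mdifferentiableAt (by simp))
    ((hα'.contMDiffAt (α.open_target.mem_nhds hy)).mdifferentiableAt (by simp))
  have h2 : α ∘ α.symm = id := funext fun z ↦ α.right_inv (ht ▸ mem_univ z)
  have h3 (v : EuclideanSpace ℝ (Fin (d + 1))) : mfderiv (𝓡 (d + 1)) (𝓡 (d + 1)) α (α.symm y)
      (mfderiv (𝓡 (d + 1)) (𝓡 (d + 1)) α.symm y v) = v := by
    refine (DFunLike.congr_fun h1 v).symm.trans ?_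
    rw [h2, mfderiv_id]
    rfl
  have key : ∀ (z z' : M) (_ : z = z') (a b : EuclideanSpace ℝ (Fin (d + 1))),
      g.val z a b = g.val z' a b := by
    rintro z _ rfl a b; rfl
  refine (key _ _ (α.right_inv hy) _ _).trans ?_
  exact congrArg₂ (fun a b ↦ g.val y a b) (h3 v) (h3 w)

end LorentzianMetric

end PullbackMetric

/-! ### The manifold obtained by gluing in the removed point -/

section Reinsertion

set_option maxSynthPendingDepth 3

open Set Filter Topology

/-- The space obtained from the target of a map defined off `p` by gluing in a neighbourhood of
`p`: a single point is added. -/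
def Reinsertion {M N : Type*} [TopologicalSpace M] [T1Space M] {p : M}
    (_ι : puncturedAt p → N) : Type _ := Option N

namespace Reinsertion

section Topology

variable {M N : Type*} [TopologicalSpace M] [T1Space M] {p : M}
  {ι : puncturedAt p → N}

/-- The inclusion of the target. -/
def inr (ι : puncturedAt p → N) (y : N) : Reinsertion ι := some y

/-- The map on `M` which extends the given one and takes `p` to the new point. -/
noncomputable def inl (ι : puncturedAt p → N) (x : M) : Reinsertion ι := by
  classical exact if hx : x ≠ p then inr ι (ι ⟨x, hx⟩) else none

theorem inl_coe (x : puncturedAt p) : inl ι x = inr ι (ι x) :=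
  dif_pos x.2

theorem inl_self : inl ι p = none :=
  dif_neg (by simp)

theorem inr_injective : Function.Injective (inr ι) := Option.some_injective N

theorem inr_ne_inl_self (y : N) : inr ι y ≠ inl ι p := by
  rw [inl_self]
  exact Option.some_ne_none y

theorem eq_inl_or_eq_inr (x : Reinsertion ι) : x = inl ι p ∨ ∃ y, x = inr ι y := by
  rw [inl_self]
  cases x with
  | none => exact Or.inl rfl
  | some y => exact Or.inr ⟨y, rfl⟩

theorem inl_eq_inr {x : M} {y : N} (hxy : inl ι x = inr ι y) :
    ∃ z : puncturedAt p, x = z ∧ y = ι z := by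
  by_cases hx : x = p
  · exact absurd (hx ▸ hxy).symm (inr_ne_inl_self y)
  · exact ⟨⟨x, hx⟩, rfl, (inr_injective ((inl_coe ⟨x, hx⟩).symm.trans hxy)).symm⟩

theorem inl_injective (hinj : Function.Injective ι) : Function.Injective (inl ι) := by
  intro x y hxy
  by_cases hy : y = p
  · subst hy
    by_contra hx
    exact inr_ne_inl_self _ ((inl_coe ⟨x, hx⟩).symm.trans hxy)
  · obtain ⟨z, rfl, hz⟩ := inl_eq_inr (hxy.trans (inl_coe ⟨y, hy⟩))
    exact congrArg Subtype.val (hinj hz).symm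

variable [TopologicalSpace N]

noncomputable instance : TopologicalSpace (Reinsertion ι) :=
  TopologicalSpace.coinduced (inl ι) inferInstance ⊔ TopologicalSpace.coinduced (inr ι) inferInstance

theorem isOpen_iff {s : Set (Reinsertion ι)} :
    IsOpen s ↔ IsOpen (inl ι ⁻¹' s) ∧ IsOpen (inr ι ⁻¹' s) := Iff.rfl

/-- The trace on `M` of an open subset `V` of `N` is `ι ⁻¹' V`, which is open in `M` because the
punctured manifold is. -/
theorem isOpenEmbedding_inr (hc : Continuous ι) : IsOpenEmbedding (inr ι) := by
  refine .of_continuous_injective_isOpenMap (continuous_def.2 fun s hs ↦ (isOpen_iff.1 hs).2)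
    inr_injective fun V hV ↦ isOpen_iff.2 ⟨?_, ?_⟩
  · convert (puncturedAt p).isOpen.isOpenMap_subtype_val _ (hV.preimage hc) using 1
    ext x
    simp only [mem_preimage, mem_image]
    constructor
    · rintro ⟨y, hy, hyx⟩
      obtain ⟨z, rfl, rfl⟩ := inl_eq_inr hyx.symm
      exact ⟨z, hy, rfl⟩
    · rintro ⟨z, hz, rfl⟩
      exact ⟨ι z, hz, (inl_coe z).symm⟩
  · rwa [preimage_image_eq _ inr_injective]

theorem isOpenEmbedding_inl (hinj : Function.Injective ι) (ho : IsOpenMap ι) :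
    IsOpenEmbedding (inl ι) := by
  refine .of_continuous_injective_isOpenMap (continuous_def.2 fun s hs ↦ (isOpen_iff.1 hs).1)
    (inl_injective hinj) fun U hU ↦ isOpen_iff.2 ⟨?_, ?_⟩
  · rwa [preimage_image_eq _ (inl_injective hinj)]
  · convert ho _ (hU.preimage continuous_subtype_val) using 1
    ext y
    simp only [mem_preimage, mem_image]
    constructor
    · rintro ⟨x, hx, hxy⟩
      obtain ⟨z, rfl, rfl⟩ := inl_eq_inr hxy
      exact ⟨z, hx, rfl⟩
    · rintro ⟨z, hz, rfl⟩
      exact ⟨z, hz, inl_coe z⟩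

/-- Two points of `N` are separated in `N`; only pairs containing the new point need `hsep`, the
absence of accumulation points. -/
theorem t2Space [T2Space N] (hc : Continuous ι) (hinj : Function.Injective ι) (ho : IsOpenMap ι)
    (hsep : ∀ q : N, ∃ U ∈ 𝓝 p, ∃ V ∈ 𝓝 q, ∀ x : puncturedAt p, (x : M) ∈ U → ι x ∉ V) :
    T2Space (Reinsertion ι) := by
  have hl := isOpenEmbedding_inl hinj ho
  have hr := isOpenEmbedding_inr hc
  have key (q : N) : Disjoint (𝓝 (inl ι p)) (𝓝 (inr ι q)) := by
    obtain ⟨U, hU, V, hV, hUV⟩ := hsep q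
    refine Filter.disjoint_iff.2
      ⟨_, hl.isOpenMap.image_mem_nhds hU, _, hr.isOpenMap.image_mem_nhds hV, ?_⟩
    rw [disjoint_left]
    rintro _ ⟨x, hx, rfl⟩ ⟨y, hy, hyx⟩
    obtain ⟨z, rfl, rfl⟩ := inl_eq_inr hyx.symm
    exact hUV z hx hy
  rw [t2Space_iff_disjoint_nhds]
  intro x y hxy
  rcases eq_inl_or_eq_inr x with rfl | ⟨x, rfl⟩ <;> rcases eq_inl_or_eq_inr y with rfl | ⟨y, rfl⟩
  · exact absurd rfl hxy
  · exact key y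
  · exact (key x).symm
  · rw [← hr.map_nhds_eq, ← hr.map_nhds_eq, Filter.disjoint_map inr_injective]
    exact disjoint_nhds_nhds.2 fun h ↦ hxy (congrArg _ h)

theorem secondCountableTopology [SecondCountableTopology M] [SecondCountableTopology N]
    (hc : Continuous ι) (hinj : Function.Injective ι) (ho : IsOpenMap ι) :
    SecondCountableTopology (Reinsertion ι) := by
  have hl := isOpenEmbedding_inl hinj ho
  have hr := isOpenEmbedding_inr hc
  let U : Bool → Set (Reinsertion ι) := fun b ↦ cond b (range (inl ι)) (range (inr ι))
  have hU : ∀ b, SecondCountableTopology (U b) := by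
    rintro (_ | _)
    · exact hr.isEmbedding.toHomeomorph.symm.secondCountableTopology
    · exact hl.isEmbedding.toHomeomorph.symm.secondCountableTopology
  refine secondCountableTopology_of_countable_cover (U := U) ?_ ?_
  · rintro (_ | _)
    · exact hr.isOpen_range
    · exact hl.isOpen_range
  · refine eq_univ_of_forall fun x ↦ mem_iUnion.2 ?_
    rcases eq_inl_or_eq_inr x with rfl | ⟨y, rfl⟩
    · exact ⟨true, mem_range_self p⟩
    · exact ⟨false, mem_range_self y⟩

/-- A frontier point of the open range of `ι` lies outside that range. In the glued space it remains
a limit of the image of `M` and is still not in it, since it is not the new point. -/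
theorem frontier_range_inl_nonempty (hc : Continuous ι) (ho : IsOpenMap ι)
    (hfr : (frontier (range ι)).Nonempty) : (frontier (range (inl ι))).Nonempty := by
  obtain ⟨q, hq⟩ := hfr
  rw [ho.isOpen_range.frontier_eq] at hq
  refine ⟨inr ι q, map_mem_closure (isOpenEmbedding_inr hc).continuous hq.1 ?_, fun h ↦ ?_⟩
  · rintro _ ⟨z, rfl⟩
    exact ⟨z, inl_coe z⟩
  · obtain ⟨x, hx⟩ := interior_subset h
    obtain ⟨z, -, rfl⟩ := inl_eq_inr hx
    exact hq.2 (mem_range_self z)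

end Topology

end Reinsertion

open LorentzianMetric

/-- Inextendibility of `M` forces an embedding of `M ∖ {p}` to have an accumulation point at `p`:
otherwise `p` could be glued in. -/
theorem LorentzianMetric.IsInextendible.exists_accumulation {d : ℕ} {M N : Type u}
    [TopologicalSpace M] [ChartedSpace (EuclideanSpace ℝ (Fin (d + 1))) M]
    [IsManifold (𝓡 (d + 1)) ∞ M] [T2Space M] [SecondCountableTopology M]
    [TopologicalSpace N] [ChartedSpace (EuclideanSpace ℝ (Fin (d + 1))) N]
    [IsManifold (𝓡 (d + 1)) ∞ N] [T2Space N] [SecondCountableTopology N]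
    {g : LorentzianMetric d M} {h : LorentzianMetric d N} (hg : g.IsInextendible) {p : M}
    {ι : puncturedAt p → N} (hι : IsExtension (g.restrict (puncturedAt p)) h ι) :
    ∃ q : N, ∀ U ∈ 𝓝 p, ∀ V ∈ 𝓝 q, ∃ x : puncturedAt p, (x : M) ∈ U ∧ ι x ∈ V := by
  -- The negation is exactly the separation hypothesis of `Reinsertion.t2Space`.
  by_contra! hsep
  have hsm := hι.isSmoothEmbedding.contMDiff
  have hinj := hι.isSmoothEmbedding.isEmbedding.injective
  have hloc := hι.preservesMetric.isLocalDiffeomorph hsm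
  have ho := hloc.isOpenMap
  have hc := hsm.continuous
  have hl := Reinsertion.isOpenEmbedding_inl hinj ho
  have hr := Reinsertion.isOpenEmbedding_inr hc
  have := Reinsertion.t2Space hc hinj ho hsep
  have := Reinsertion.secondCountableTopology hc hinj ho
  obtain ⟨q, -⟩ := hι.frontier_nonempty
  have : Nonempty M := ⟨p⟩
  have : Nonempty N := ⟨q⟩
  let α := (hl.toOpenPartialHomeomorph (Reinsertion.inl ι)).symm
  let β := (hr.toOpenPartialHomeomorph (Reinsertion.inr ι)).symm
  have hαs : α.source = range (Reinsertion.inl ι) := by simp [α]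
  have hβs : β.source = range (Reinsertion.inr ι) := by simp [β]
  have hαt : α.target = univ := by simp [α]
  have hαi : (α.symm : M → Reinsertion ι) = Reinsertion.inl ι := by simp [α]
  have hβi : (β.symm : N → Reinsertion ι) = Reinsertion.inr ι := by simp [β]
  have hαl (x : M) : α (Reinsertion.inl ι x) = x := by
    rw [← hαi]; exact α.right_inv (hαt ▸ mem_univ x)
  have hβr (y : N) : β (Reinsertion.inr ι y) = y := by
    rw [← hβi]; exact β.right_inv (by simp [β])
  have hcov : ∀ x, x ∈ α.source ∨ x ∈ β.source := by
    intro x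
    rw [hαs, hβs]
    rcases Reinsertion.eq_inl_or_eq_inr x with rfl | ⟨y, rfl⟩
    · exact Or.inl (mem_range_self p)
    · exact Or.inr (mem_range_self y)
  have hinter : ∀ x ∈ α.source ∩ β.source, ∃ z : puncturedAt p, x = Reinsertion.inl ι z ∧
      x = Reinsertion.inr ι (ι z) := by
    rw [hαs, hβs]
    rintro _ ⟨⟨x, rfl⟩, y, hy⟩
    obtain ⟨z, rfl, -⟩ := Reinsertion.inl_eq_inr hy.symm
    exact ⟨z, rfl, Reinsertion.inl_coe z⟩
  -- The transition map from `M` to `N`. Its value at `p` is arbitrary and harmless, since the new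
  -- point is not in `β.source`.
  let j : M → N := fun x ↦ β (Reinsertion.inl ι x)
  have hj : ∀ x : puncturedAt p, j x = ι x := fun x ↦ by
    simp only [j, Reinsertion.inl_coe, hβr]
  have hjs := contMDiffAt_of_eq_puncturedAt hsm hj
  have h1 : ContMDiffOn (𝓡 (d + 1)) (𝓡 (d + 1)) ∞ (β ∘ α.symm) (α.symm.trans β).source := by
    rw [hαi]
    intro x hx
    have hx' : Reinsertion.inl ι x ∈ α.source ∩ β.source := by
      refine ⟨hαs ▸ mem_range_self x, ?_⟩
      rw [← hαi]
      exact hx.2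
    obtain ⟨z, hz, -⟩ := hinter _ hx'
    obtain rfl := Reinsertion.inl_injective hinj hz
    exact (hjs z).1.contMDiffWithinAt
  have h2 : ContMDiffOn (𝓡 (d + 1)) (𝓡 (d + 1)) ∞ (α ∘ β.symm) (β.symm.trans α).source := by
    rw [hβi]
    intro y hy
    have hy' : Reinsertion.inr ι y ∈ α.source ∩ β.source := by
      refine ⟨?_, hβs ▸ mem_range_self y⟩
      rw [← hβi]
      exact hy.2
    obtain ⟨z, -, hz⟩ := hinter _ hy'
    obtain rfl := Reinsertion.inr_injective hz
    -- The reverse transition map is locally an inverse of `ι`, smooth because `ι` is a local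
    -- diffeomorphism.
    obtain ⟨Φ, hzΦ, hΦ⟩ := hloc z
    have hmem : ι z ∈ Φ.target := hΦ hzΦ ▸ Φ.map_source hzΦ
    have h3 : ContMDiffAt (𝓡 (d + 1)) (𝓡 (d + 1)) ∞ (fun y ↦ (Φ.symm y : M)) (ι z) :=
      contMDiff_subtype_val.contMDiffAt.comp (ι z)
        (Φ.contMDiffOn_invFun.contMDiffAt (Φ.open_target.mem_nhds hmem))
    refine (h3.congr_of_eventuallyEq ?_).contMDiffWithinAt
    filter_upwards [Φ.open_target.mem_nhds hmem] with u hu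
    have h4 : ι (Φ.symm u) = u := (hΦ (Φ.map_target hu)).trans (Φ.right_inv hu)
    change α (Reinsertion.inr ι u) = (Φ.symm u : M)
    conv_lhs => rw [← h4, ← Reinsertion.inl_coe, hαl]
  let _ := ChartedSpace.ofCover (H := EuclideanSpace ℝ (Fin (d + 1))) α β hcov
  have := isManifold_ofCover α β hcov h1 h2
  obtain ⟨hα, hα'⟩ := contMDiffOn_of_forall_trans_chartAt_mem_atlas (d := d) α
    fun y ↦ Or.inl ⟨y, rfl⟩
  obtain ⟨hβ, hβ'⟩ := contMDiffOn_of_forall_trans_chartAt_mem_atlas (d := d) β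
    fun y ↦ Or.inr ⟨y, rfl⟩
  obtain ⟨k, hk⟩ := exists_of_cover g h hcov hα hα' hβ hβ' (j := j) (by
    intro x hx
    obtain ⟨z, rfl, hz⟩ := hinter x hx
    rw [hαl]
    exact ⟨rfl, (hjs z).1.mdifferentiableAt (by simp),
      val_mfderiv_of_preservesMetric hsm hι.preservesMetric hj z.2⟩)
  have hpres := preservesMetric_symm_of_target_eq_univ hα hα' hαt hk
  rw [hαi] at hpres
  rw [hαi, hαt, contMDiffOn_univ] at hα'
  exact hg _ k (Reinsertion.inl ι)
    ⟨(hpres.isLocalDiffeomorph hα').isSmoothEmbedding (Reinsertion.inl_injective hinj), hpres,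
      Reinsertion.frontier_range_inl_nonempty hc ho hι.frontier_nonempty⟩

end Reinsertion

/-! ### The removed point is reinserted -/

theorem theoremA4 {d : ℕ} (hd : 1 ≤ d)
    {M : Type u} [TopologicalSpace M] [ChartedSpace (EuclideanSpace ℝ (Fin (d + 1))) M]
    [IsManifold (𝓡 (d + 1)) ∞ M] [T2Space M] [SecondCountableTopology M] [ConnectedSpace M]
    (g : LorentzianMetric d M) (hT : g.IsTimeOrientable) (hg : g.IsInextendible) (p : M)
    {N : Type u} [TopologicalSpace N] [ChartedSpace (EuclideanSpace ℝ (Fin (d + 1))) N]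
    [IsManifold (𝓡 (d + 1)) ∞ N] [T2Space N] [SecondCountableTopology N] [ConnectedSpace N]
    (h : LorentzianMetric d N) (ι : puncturedAt p → N)
    (hι : LorentzianMetric.IsExtension (g.restrict (puncturedAt p)) h ι) :
    ∃ Φ : Diffeomorph (𝓡 (d + 1)) (𝓡 (d + 1)) M N ∞,
      LorentzianMetric.PreservesMetric g h Φ ∧ ∀ x : puncturedAt p, Φ (x : M) = ι x := by
  classical
  obtain ⟨q, hq⟩ := hg.exists_accumulation hι
  have hsm := hι.isSmoothEmbedding.contMDiff
  have hinj := hι.isSmoothEmbedding.isEmbedding.injective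
  have hpres := hι.preservesMetric
  -- The accumulation point is the only possible value at `p` of a continuous extension.
  let j : M → N := fun x ↦ if hx : x ≠ p then ι ⟨x, hx⟩ else q
  have hj : ∀ x : puncturedAt p, j x = ι x := fun x ↦ dif_pos x.2
  have hjp : j p = q := dif_neg (by simp)
  have hcl : ∀ U ∈ nhds p, ∀ V ∈ nhds (j p), ∃ x ≠ p, x ∈ U ∧ j x ∈ V := by
    intro U hU V hV
    obtain ⟨x, hxU, hxV⟩ := hq U hU V (hjp ▸ hV)
    exact ⟨x, x.2, hxU, by rwa [hj]⟩
  obtain ⟨hjs, hjg⟩ :=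
    LorentzianMetric.contMDiff_and_preservesMetric_of_accumulation hd hsm hpres hinj hj hcl
  have hji := LorentzianMetric.injective_of_accumulation (hpres.isLocalDiffeomorph hsm).isOpenMap
    hinj hj hcl
  exact ⟨(hjg.isLocalDiffeomorph hjs).diffeomorphOfBijective ⟨hji, hg.surjective hjs hjg hji⟩,
    hjg, hj⟩
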